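/- **Setting.** Let $(Z,d)$ be a separable metric space that is locally complete (every point has a complete neighbourhood), and let $\mu$ be a Borel measure on $Z$ that is positive and finite on every ball and infinitesimally doubling, i.e. $\limsup_{r\to0^+}\mu(B(z,2r))/\mu(B(z,r))<\infty$ for $\mu$-almost every $z\in Z$. **Definitions.** A curve is a continuous map $\gamma\colon[a,b]\to Z$, with length $\ell(\gamma)$; for rectifiable $\gamma$ and Borel $\rho\colon Z\to[0,\infty]$, $\int_\gamma\rho\,ds$ is the integral with respect to arc length. A family $\Gamma$ of curves is *$\infty$-negligible* if there is a Borel $\rho\colon Z\to[0,\infty]$ with $\|\rho\|_{L^\infty(Z)}=0$ and $\int_\gamma\rho\,ds=\infty$ for every rectifiable $\gamma\in\Gamma$. A Borel $\rho\colon Z\to[0,\infty]$ is an *$\infty$-weak upper gradient* of $u\colon Z\to\mathbb R$ if $|u(\gamma(a))-u(\gamma(b))|\le\int_\gamma\rho\,ds$ for all nonconstant curves $\gamma$ outside an $\infty$-negligible family. * $W^{1,\infty}(Z)$ is the set of $u\in L^\infty(Z)$ that agree almost everywhere with some $\widehat u\colon Z\to\mathbb R$ having an essentially bounded $\infty$-weak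 upper gradient; its energy seminorm is $\mathscr E_\infty(u)=\inf_\rho\|\rho\|_{L^\infty(Z)}$ over all such gradients $\rho$ of such a representative $\widehat u$ (the value does not depend on $\widehat u$), and $\|u\|_{W^{1,\infty}(Z)}=\|u\|_{L^\infty(Z)}+\mathscr E_\infty(u)$. * ${\rm LIP}^\infty(Z)\subset L^\infty(Z)$ is the set of classes of bounded Lipschitz functions; its energy seminorm $\mathrm{lip}(u)$ is the smallest Lipschitz constant of the Lipschitz representative, and $\|u\|_{{\rm LIP}^\infty(Z)}=\|u\|_{L^\infty(Z)}+\mathrm{lip}(u)$. * $Z$ is *$C$-quasiconvex* if any $x,y\in Z$ are joined by a curve of length at most $C\,d(x,y)$. $Z$ is *very $\infty$-thick $C$-quasiconvex* if for all $x,y\in Z$ the family of curves $\gamma\colon[0,1]\to Z$ from $x$ to $y$ with $\ell(\gamma)\le C\,d(x,y)$ is not $\infty$-negligible. * $Z$ supports a *weak $(1,\infty)$-Poincaré inequality* with constants $P>0$, $\Lambda\ge1$ if for every ball $B=B(x,r)$, every $u\colon Z\to\mathbb R$ integrable on bounded sets and every $\infty$-weak upper gradient $\rho$ of $u$, with $\Lambda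 B=B(x,\Lambda r)$ and $u_B$ the average of $u$ over $B$, $$\frac1{\mu(B)}\int_B|u-u_B|\,d\mu\le P\,\mathrm{diam}(B)\,\|\rho\|_{L^\infty(\Lambda B)}.$$ **Theorem.** The following are equivalent: 1. ${\rm LIP}^\infty(Z)=W^{1,\infty}(Z)$ and $Z$ is $C_1$-quasiconvex for some $C_1\ge1$; 2. $Z$ is very $\infty$-thick $C$-quasiconvex for some $C\ge1$; 3. ${\rm LIP}^\infty(Z)=W^{1,\infty}(Z)$ and there is $K\ge1$ with $\mathrm{lip}(u)\le K\,\mathscr E_\infty(u)$ and $\mathscr E_\infty(u)\le K\,\mathrm{lip}(u)$ for all $u\in W^{1,\infty}(Z)$. Each of them implies that $Z$ supports a weak $(1,\infty)$-Poincaré inequality. Moreover, all of this is quantitative: taking as data of (1) the constant $C_1$ together with a constant $c\in(0,1]$ such that $c\|u\|_{{\rm LIP}^\infty(Z)}\le\|u\|_{W^{1,\infty}(Z)}\le\|u\|_{{\rm LIP}^\infty(Z)}$ for all $u\in W^{1,\infty}(Z)$, as data of (2) the constant $C$, and as data of (3) the constant $K$, each condition implies the two others and the Poincaré inequality with constants ($(c,C_1)$,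 $C$, $K$ and $(P,\Lambda)$, respectively) that depend only on the data of the assumed condition, and not on $Z$ or $\mu$. -/

import Mathlib

open MeasureTheory Set Filter Topology
open scoped ENNReal NNReal

universe u

noncomputable section

namespace ThickQC

/-! ### Metric measure spaces -/

/-- `Z` is locally complete: every point has a complete neighbourhood. -/
def LocallyComplete (Z : Type*) [MetricSpace Z] : Prop :=
  ∀ z : Z, ∃ s ∈ 𝓝 z, IsComplete s

/-- `limsup_{r → 0+} μ(B(z,2r)) / μ(B(z,r)) < ∞` for almost every `z`. -/
def InfinitesimallyDoubling {Z : Type*} [MetricSpace Z] [MeasurableSpace Z]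
    (μ : Measure Z) : Prop :=
  ∀ᵐ z ∂μ, limsup (fun r : ℝ => μ (Metric.ball z (2 * r)) / μ (Metric.ball z r)) (𝓝[>] 0) < ∞

/-- The standing assumptions on the metric measure space `(Z, d, μ)`. -/
structure IsAdmissible {Z : Type*} [MetricSpace Z] [MeasurableSpace Z] (μ : Measure Z) :
    Prop where
  locallyComplete : LocallyComplete Z
  ball_pos : ∀ (z : Z) (r : ℝ), 0 < r → 0 < μ (Metric.ball z r)
  ball_lt_top : ∀ (z : Z) (r : ℝ), 0 < r → μ (Metric.ball z r) < ∞
  infinitesimallyDoubling : InfinitesimallyDoubling μ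

/-! ### Curves -/

/-- A curve `γ : [left, right] → Z`. Only the values of `toFun` on `[left, right]` are
ever used. -/
structure Curve (Z : Type*) [MetricSpace Z] where
  left : ℝ
  right : ℝ
  left_le_right : left ≤ right
  toFun : ℝ → Z
  continuousOn : ContinuousOn toFun (Icc left right)

namespace Curve

variable {Z : Type*} [MetricSpace Z]

/-- The initial point of a curve. -/
def source (γ : Curve Z) : Z := γ.toFun γ.left

/-- The final point of a curve. -/
def target (γ : Curve Z) : Z := γ.toFun γ.right

/-- The length of a curve: supremum over partitions of the sums of distances. -/
def length (γ : Curve Z) : ℝ≥0∞ := eVariationOn γ.toFun (Icc γ.left γ.right)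

/-- Finite length. -/
def Rectifiable (γ : Curve Z) : Prop := γ.length < ∞

/-- The curve is constant on its domain. -/
def IsConstant (γ : Curve Z) : Prop :=
  ∀ s ∈ Icc γ.left γ.right, ∀ t ∈ Icc γ.left γ.right, γ.toFun s = γ.toFun t

/-- The arc length reparametrization `γ̂` on `[0, ℓ(γ)]`, characterised for rectifiable `γ`
by `γ̂ (ℓ(γ|[left, t])) = γ t`. -/
def arcLength (γ : Curve Z) : ℝ → Z :=
  naturalParameterization γ.toFun (Icc γ.left γ.right) γ.left

/-- The curve integral `∫_γ ρ ds = ∫_0^{ℓ(γ)} ρ(γ̂(s)) ds` (used for rectifiable `γ`). -/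
def integral (ρ : Z → ℝ≥0∞) (γ : Curve Z) : ℝ≥0∞ :=
  ∫⁻ s in Icc 0 γ.length.toReal, ρ (γ.arcLength s)

end Curve

/-- A curve family is `∞`-negligible if some nonnegative Borel function, vanishing almost
everywhere, has infinite integral over all its rectifiable members. -/
def Negligible {Z : Type*} [MetricSpace Z] [MeasurableSpace Z] (μ : Measure Z)
    (Γ : Set (Curve Z)) : Prop :=
  ∃ ρ : Z → ℝ≥0∞, Measurable ρ ∧ essSup ρ μ = 0 ∧
    ∀ γ ∈ Γ, γ.Rectifiable → γ.integral ρ = ∞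

/-! ### Quasiconvexity and thick quasiconvexity -/

/-- `C`-quasiconvexity. -/
def Quasiconvex (Z : Type*) [MetricSpace Z] (C : ℝ≥0) : Prop :=
  ∀ x y : Z, ∃ γ : Curve Z, γ.Rectifiable ∧ γ.source = x ∧ γ.target = y ∧
    γ.length ≤ C * edist x y

/-- The family `Γ(x, y; C)` of curves `[0,1] → Z` from `x` to `y` of length at most
`C d(x,y)`. -/
def joiningFamily {Z : Type*} [MetricSpace Z] (x y : Z) (C : ℝ≥0) : Set (Curve Z) :=
  {γ | γ.left = 0 ∧ γ.right = 1 ∧ γ.toFun 0 = x ∧ γ.toFun 1 = y ∧ γ.length ≤ C * edist x y}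

/-- `Z` is very `∞`-thick `(C, R)`-quasiconvex. The value `R = ∞` is allowed, in which case
the ball `B(x₀, R)` is all of `Z`. -/
def VeryThickQuasiconvex {Z : Type*} [MetricSpace Z] [MeasurableSpace Z] (μ : Measure Z)
    (C : ℝ≥0) (R : ℝ≥0∞) : Prop :=
  ∀ x₀ : Z, ∀ x ∈ Metric.eball x₀ R, ∀ y ∈ Metric.eball x₀ R,
    ¬ Negligible μ (joiningFamily x y C)

/-! ### Upper gradients and the Sobolev space -/

/-- `ρ` is an `∞`-weak upper gradient of `u`. -/
def IsWeakUpperGradient {Z : Type*} [MetricSpace Z] [MeasurableSpace Z] (μ : Measure Z)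
    (u : Z → ℝ) (ρ : Z → ℝ≥0∞) : Prop :=
  Measurable ρ ∧
    Negligible μ {γ : Curve Z | ¬ γ.IsConstant ∧
      ¬ (ENNReal.ofReal |u γ.source - u γ.target| ≤ γ.integral ρ)}

/-- The essentially bounded `∞`-weak upper gradients of `u`. -/
def boundedGradients {Z : Type*} [MetricSpace Z] [MeasurableSpace Z] (μ : Measure Z)
    (u : Z → ℝ) : Set (Z → ℝ≥0∞) :=
  {ρ | IsWeakUpperGradient μ u ρ ∧ essSup ρ μ < ∞}

/-- The essentially bounded functions possessing an essentially bounded `∞`-weak upper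
gradient (before identification of functions). -/
def NewtonSobolev {Z : Type*} [MetricSpace Z] [MeasurableSpace Z] (μ : Measure Z) :
    Set (Z → ℝ) :=
  {u | MemLp u ∞ μ ∧ (boundedGradients μ u).Nonempty}

/-- The Newtonian energy of a function: infimum of the `L^∞` norms of its gradients. -/
def newtonEnergy {Z : Type*} [MetricSpace Z] [MeasurableSpace Z] (μ : Measure Z)
    (u : Z → ℝ) : ℝ≥0∞ :=
  ⨅ ρ ∈ boundedGradients μ u, essSup ρ μ

/-- `W^{1,∞}(Z)`, as a set of classes in `L^∞(Z)`. -/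
def sobolev {Z : Type*} [MetricSpace Z] [MeasurableSpace Z] (μ : Measure Z) :
    Set (Lp ℝ ∞ μ) :=
  {u | ∃ v ∈ NewtonSobolev μ, u =ᵐ[μ] v}

/-- The energy seminorm of `W^{1,∞}(Z)`. All representatives in `NewtonSobolev μ` have the
same energy, so the infimum over them is their common value. -/
def sobolevEnergy {Z : Type*} [MetricSpace Z] [MeasurableSpace Z] (μ : Measure Z)
    (u : Lp ℝ ∞ μ) : ℝ≥0∞ :=
  ⨅ v ∈ {v ∈ NewtonSobolev μ | u =ᵐ[μ] v}, newtonEnergy μ v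

/-- The norm of `W^{1,∞}(Z)`. -/
def sobolevNorm {Z : Type*} [MetricSpace Z] [MeasurableSpace Z] (μ : Measure Z)
    (u : Lp ℝ ∞ μ) : ℝ≥0∞ :=
  eLpNorm u ∞ μ + sobolevEnergy μ u

/-! ### Bounded Lipschitz functions -/

/-- The bounded Lipschitz functions on `Z`. -/
def BoundedLipschitz (Z : Type*) [MetricSpace Z] : Set (Z → ℝ) :=
  {f | (∃ L : ℝ≥0, LipschitzWith L f) ∧ ∃ M : ℝ, ∀ x, |f x| ≤ M}

/-- The smallest Lipschitz constant of `f`. -/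
def lipConst {Z : Type*} [MetricSpace Z] (f : Z → ℝ) : ℝ≥0∞ :=
  ⨅ (L : ℝ≥0) (_ : LipschitzWith L f), (L : ℝ≥0∞)

/-- `LIP^∞(Z)`, embedded as a set of classes in `L^∞(Z)`. -/
def lipSpace {Z : Type*} [MetricSpace Z] [MeasurableSpace Z] (μ : Measure Z) :
    Set (Lp ℝ ∞ μ) :=
  {u | ∃ f ∈ BoundedLipschitz Z, u =ᵐ[μ] f}

/-- The Lipschitz energy seminorm of a class in `LIP^∞(Z)`. When balls have positive measure
the Lipschitz representative is unique. -/
def lipEnergy {Z : Type*} [MetricSpace Z] [MeasurableSpace Z] (μ : Measure Z)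
    (u : Lp ℝ ∞ μ) : ℝ≥0∞ :=
  ⨅ f ∈ {f ∈ BoundedLipschitz Z | u =ᵐ[μ] f}, lipConst f

/-- The norm of `LIP^∞(Z)`. -/
def lipNorm {Z : Type*} [MetricSpace Z] [MeasurableSpace Z] (μ : Measure Z)
    (u : Lp ℝ ∞ μ) : ℝ≥0∞ :=
  eLpNorm u ∞ μ + lipEnergy μ u

/-- The norms are comparable: `c ‖u‖_LIP ≤ ‖u‖_W ≤ ‖u‖_LIP` on `W^{1,∞}(Z)`. -/
def NormsComparable {Z : Type*} [MetricSpace Z] [MeasurableSpace Z] (μ : Measure Z)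
    (c : ℝ≥0) : Prop :=
  ∀ u ∈ sobolev μ, c * lipNorm μ u ≤ sobolevNorm μ u ∧ sobolevNorm μ u ≤ lipNorm μ u

/-- The energy seminorms are comparable with constant `K` on `W^{1,∞}(Z)`. -/
def EnergiesComparable {Z : Type*} [MetricSpace Z] [MeasurableSpace Z] (μ : Measure Z)
    (K : ℝ≥0) : Prop :=
  ∀ u ∈ sobolev μ, lipEnergy μ u ≤ K * sobolevEnergy μ u ∧
    sobolevEnergy μ u ≤ K * lipEnergy μ u

/-! ### The Poincaré inequality -/

/-- The (global) weak `(1,∞)`-Poincaré inequality with constants `(C, Λ)`: for all balls `B`,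
all `u` integrable on bounded sets, and all `∞`-weak upper gradients `ρ` of `u`,
`⨍_B |u - u_B| dμ ≤ C diam(B) ‖ρ‖_{L^∞(ΛB)}`. -/
def WeakPoincare {Z : Type*} [MetricSpace Z] [MeasurableSpace Z] (μ : Measure Z)
    (C Λ : ℝ≥0) : Prop :=
  ∀ (x : Z) (r : ℝ), 0 < r → ∀ u : Z → ℝ,
    (∀ s : Set Z, Bornology.IsBounded s → IntegrableOn u s μ) →
    ∀ ρ : Z → ℝ≥0∞, IsWeakUpperGradient μ u ρ →
      ENNReal.ofReal
          (⨍ z in Metric.ball x r, |u z - ⨍ w in Metric.ball x r, u w ∂μ| ∂μ) ≤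
        C * Metric.ediam (Metric.ball x r) *
          essSup ρ (μ.restrict (Metric.ball x (Λ * r)))

/-! ### The three conditions, with their constants -/

/-- `LIP^∞(Z) = W^{1,∞}(Z)` with norm comparability constant `c`, and `Z` is
`C`-quasiconvex. -/
def Condition1 {Z : Type*} [MetricSpace Z] [MeasurableSpace Z] (μ : Measure Z)
    (c C : ℝ≥0) : Prop :=
  lipSpace μ = sobolev μ ∧ NormsComparable μ c ∧ Quasiconvex Z C

/-- `Z` is very `∞`-thick `C`-quasiconvex at all scales. -/
def Condition2 {Z : Type*} [MetricSpace Z] [MeasurableSpace Z] (μ : Measure Z)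
    (C : ℝ≥0) : Prop :=
  VeryThickQuasiconvex μ C ∞

/-- `LIP^∞(Z) = W^{1,∞}(Z)` with energy seminorms comparable with constant `K`. -/
def Condition3 {Z : Type*} [MetricSpace Z] [MeasurableSpace Z] (μ : Measure Z)
    (K : ℝ≥0) : Prop :=
  lipSpace μ = sobolev μ ∧ EnergiesComparable μ K

end ThickQC

end

/-! Negligibility is a statement about null sets: a family is negligible exactly when some Borel
null set `E` is met for positive time by each of its rectifiable members (`negligible_iff`).
Thickness thus means that every null set can be avoided by short curves joining any two given
points.

From thickness everything else follows by integration. A weak upper gradient of `u` controls `u`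
along curves avoiding a suitable null set, and on such curves it is at most its essential supremum.
Joining `x` to `y` by one of them gives `|u x - u y| ≤ C d(x,y) ‖ρ‖` for all `x`, `y`, hence
Lipschitz regularity and comparable energies. Since these curves stay near their endpoints, the
estimate localizes and yields the Poincaré inequality.

Conversely, fix a null set `E` and let `pathDist` be the truncated infimal length of paths avoiding
`E` that start in a small ball around `x`. Its sublevel sets are analytic, so it is almost
everywhere measurable, and it has weak upper gradient `1`. The hypothesis makes it Lipschitz off a
null set, so some path of length at most a constant times `d(x,y)` avoids `E` and joins points
arbitrarily close to `x` and `y`. Avoidance does not pass to limits of paths, so the exact endpoints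
are reached by filling the two remaining gaps again and again: the time still unassigned decays
geometrically, and the limit path avoids `E` (`avoidingPath_of_approx`). This needs completeness; it
is done in the completion, where `Z` is open, and the filling paths are so short that they stay in
`Z`.

Comparable energies allow any truncation level, hence all pairs of points. Comparable norms control
only level `1`, hence nearby points, and quasiconvexity chains these together. If only the equality
of spaces is known, Baire category supplies a uniform Lipschitz constant. -/

noncomputable section

namespace ThickQC

/-! ### Unit speed paths avoiding a set -/

section Paths

variable {X : Type*} [MetricSpace X]

/-- `σ` is `1`-Lipschitz on `[0, L]` and spends zero time in `E`. -/
structure IsAvoiding (E : Set X) (σ : ℝ → X) (L : ℝ) : Prop where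
  nonneg : 0 ≤ L
  dist_le : ∀ s t, 0 ≤ s → s ≤ t → t ≤ L → dist (σ s) (σ t) ≤ t - s
  null : volume (Icc 0 L ∩ σ ⁻¹' E) = 0

/-- There is a path of length at most `L` from `x` to `y` spending zero time in `E`. -/
def AvoidingPath (E : Set X) (x y : X) (L : ℝ) : Prop :=
  ∃ σ : ℝ → X, IsAvoiding E σ L ∧ σ 0 = x ∧ σ L = y

theorem AvoidingPath.nonneg {E : Set X} {x y : X} {L : ℝ} (h : AvoidingPath E x y L) : 0 ≤ L := by
  obtain ⟨σ, h, -⟩ := h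
  exact h.nonneg

theorem AvoidingPath.dist_le {E : Set X} {x y : X} {L : ℝ} (h : AvoidingPath E x y L) :
    dist x y ≤ L := by
  obtain ⟨σ, h, rfl, rfl⟩ := h
  simpa using h.dist_le 0 L le_rfl h.nonneg le_rfl

theorem AvoidingPath.refl (E : Set X) (x : X) : AvoidingPath E x x 0 := by
  refine ⟨fun _ => x, ⟨le_rfl, fun s t _ h _ => by simpa using h, ?_⟩, rfl, rfl⟩
  exact measure_mono_null inter_subset_left (by simp)

theorem AvoidingPath.symm {E : Set X} {x y : X} {L : ℝ} (h : AvoidingPath E x y L) :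
    AvoidingPath E y x L := by
  obtain ⟨σ, h, rfl, rfl⟩ := h
  refine ⟨fun t => σ (L - t), ⟨h.nonneg, fun s t hs hst ht => ?_, ?_⟩, by simp, by simp⟩
  · rw [dist_comm]
    have := h.dist_le (L - t) (L - s) (by linarith) (by linarith) (by linarith)
    linarith
  · have h0 := (Measure.measurePreserving_sub_left volume L).quasiMeasurePreserving.preimage_null h.null
    refine measure_mono_null ?_ h0
    rintro t ⟨⟨h1, h2⟩, h3⟩
    exact ⟨⟨by linarith, by linarith⟩, h3⟩

theorem AvoidingPath.trans {E : Set X} {x y z : X} {L M : ℝ} (h : AvoidingPath E x y L)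
    (h' : AvoidingPath E y z M) : AvoidingPath E x z (L + M) := by
  obtain ⟨σ, h, rfl, rfl⟩ := h
  obtain ⟨τ, h', h0, rfl⟩ := h'
  have hL := h.nonneg
  have hM := h'.nonneg
  refine ⟨fun t => if t ≤ L then σ t else τ (t - L), ⟨by positivity, fun s t hs hst ht => ?_, ?_⟩,
    by simp [hL], ?_⟩
  · split_ifs with h1 h2 h2
    · exact h.dist_le s t hs hst h2
    · have a1 := h.dist_le s L hs h1 le_rfl
      have a2 := h'.dist_le 0 (t - L) le_rfl (by linarith) (by linarith)
      rw [h0] at a2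
      linarith [dist_triangle (σ s) (σ L) (τ (t - L))]
    · linarith
    · have := h'.dist_le (s - L) (t - L) (by linarith) (by linarith) (by linarith)
      linarith
  · have n2 := (measurePreserving_sub_right volume L).quasiMeasurePreserving.preimage_null h'.null
    refine measure_mono_null ?_ (measure_union_null h.null n2)
    rintro t ⟨⟨h1, h2⟩, h3⟩
    by_cases htL : t ≤ L
    · left
      simp only [mem_preimage, htL, if_true] at h3
      exact ⟨⟨h1, htL⟩, h3⟩
    · right
      simp only [mem_preimage, htL, if_false] at h3
      exact ⟨⟨by linarith, by linarith⟩, h3⟩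
  · by_cases hM0 : M = 0
    · simp [hM0, ← h0]
    · have : 0 < M := lt_of_le_of_ne hM (Ne.symm hM0)
      simp [this]

/-- A nondegenerate path may be traversed more slowly. -/
theorem AvoidingPath.mono {E : Set X} {x y : X} {L M : ℝ} (h : AvoidingPath E x y L)
    (hL : 0 < L) (hLM : L ≤ M) : AvoidingPath E x y M := by
  obtain ⟨σ, h, rfl, rfl⟩ := h
  have hM : 0 < M := hL.trans_le hLM
  have hr : 0 < L / M := by positivity
  have hr1 : L / M ≤ 1 := (div_le_one hM).2 hLM
  refine ⟨fun t => σ (L / M * t), ⟨hM.le, fun s t hs hst ht => ?_, ?_⟩, by simp, ?_⟩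
  · have := h.dist_le (L / M * s) (L / M * t) (by positivity) (by gcongr) (by
      calc L / M * t ≤ L / M * M := by gcongr
        _ = L := by field_simp)
    nlinarith
  · have : volume ((fun t => L / M * t) ⁻¹' (Icc 0 L ∩ σ ⁻¹' E)) = 0 := by
      rw [Real.volume_preimage_mul_left hr.ne', h.null, mul_zero]
    refine measure_mono_null ?_ this
    rintro t ⟨⟨h1, h2⟩, h3⟩
    refine ⟨⟨by positivity, ?_⟩, h3⟩
    calc L / M * t ≤ L / M * M := by gcongr
        _ = L := by field_simp
  · dsimp only
    congr 1
    field_simp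

theorem AvoidingPath.pos_of_ne {E : Set X} {x y : X} {L : ℝ} (h : AvoidingPath E x y L)
    (hxy : x ≠ y) : 0 < L :=
  (dist_pos.2 hxy).trans_le h.dist_le

theorem AvoidingPath.image {Y : Type*} [MetricSpace Y] {E : Set X} {x y : X} {L : ℝ}
    (h : AvoidingPath E x y L) {f : X → Y} (hf : Isometry f) :
    AvoidingPath (f '' E) (f x) (f y) L := by
  obtain ⟨σ, h, rfl, rfl⟩ := h
  refine ⟨f ∘ σ, ⟨h.nonneg, fun s t hs hst ht => ?_, ?_⟩, rfl, rfl⟩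
  · simpa [hf.dist_eq] using h.dist_le s t hs hst ht
  · rw [preimage_comp, preimage_image_eq _ hf.injective]
    exact h.null

/-- A path staying close to its initial point in the range of an isometry can be lifted. -/
theorem AvoidingPath.of_image {Y : Type*} [MetricSpace Y] {E : Set X} {x y : X} {L : ℝ}
    {f : X → Y} (hf : Isometry f) (h : AvoidingPath (f '' E) (f x) (f y) L)
    (hr : Metric.closedBall (f x) L ⊆ range f) : AvoidingPath E x y L := by
  obtain ⟨σ, h, h0, h1⟩ := h
  have hσ : ∀ t ∈ Icc 0 L, ∃ z, f z = σ t := fun t ht => by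
    refine hr ?_
    rw [Metric.mem_closedBall, dist_comm, ← h0]
    linarith [h.dist_le 0 t le_rfl ht.1 ht.2, ht.2]
  have : Nonempty X := ⟨x⟩
  choose! τ hτ using hσ
  refine ⟨τ, ⟨h.nonneg, fun s t hs hst ht => ?_, ?_⟩, ?_, ?_⟩
  · rw [← hf.dist_eq, hτ s ⟨hs, hst.trans ht⟩, hτ t ⟨hs.trans hst, ht⟩]
    exact h.dist_le s t hs hst ht
  · refine measure_mono_null ?_ h.null
    rintro t ⟨ht, hE⟩
    exact ⟨ht, τ t, hE, hτ t ht⟩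
  · exact hf.injective ((hτ 0 ⟨le_rfl, h.nonneg⟩).trans h0)
  · exact hf.injective ((hτ L ⟨h.nonneg, le_rfl⟩).trans h1)

end Paths

/-! ### Arc length parametrizations -/

section ArcLength

variable {Z : Type*} [MetricSpace Z]

theorem continuousOn_variationOnFromTo {f : ℝ → Z} {a b : ℝ}
    (hf : ContinuousOn f (Icc a b)) (hv : BoundedVariationOn f (Icc a b)) {c : ℝ}
    (hc : c ∈ Icc a b) : ContinuousOn (variationOnFromTo f (Icc a b) c) (Icc a b) := by
  intro x hx
  have hl := hv.locallyBoundedVariationOn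
  have h1 := hv.tendsto_eVariationOn_Icc_zero_left (x := x) ((hf x hx).mono inter_subset_left)
  have h2 := hv.tendsto_eVariationOn_Icc_zero_right x ((hf x hx).mono inter_subset_left)
  have h3 := (ENNReal.tendsto_toReal ENNReal.zero_ne_top).comp h1
  have h4 := (ENNReal.tendsto_toReal ENNReal.zero_ne_top).comp h2
  have h5 := h3.add h4
  simp only [ENNReal.toReal_zero, add_zero] at h5
  rw [ContinuousWithinAt, tendsto_iff_dist_tendsto_zero]
  refine squeeze_zero' (Eventually.of_forall fun _ => dist_nonneg) ?_ h5
  filter_upwards [self_mem_nhdsWithin] with y hy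
  rw [Real.dist_eq, variationOnFromTo.sub_right hl hc hy hx]
  rcases le_total x y with h | h
  · rw [variationOnFromTo.eq_of_le _ _ h, abs_of_nonneg ENNReal.toReal_nonneg]
    simp
  · rw [variationOnFromTo.eq_of_ge _ _ h, abs_neg, abs_of_nonneg ENNReal.toReal_nonneg]
    simp

namespace Curve

variable (γ : Curve Z)

theorem left_mem : γ.left ∈ Icc γ.left γ.right := ⟨le_rfl, γ.left_le_right⟩

theorem right_mem : γ.right ∈ Icc γ.left γ.right := ⟨γ.left_le_right, le_rfl⟩

/-- The length of the initial segment of a curve. -/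
def partialLength (t : ℝ) : ℝ := variationOnFromTo γ.toFun (Icc γ.left γ.right) γ.left t

variable {γ}

theorem Rectifiable.boundedVariationOn (h : γ.Rectifiable) :
    BoundedVariationOn γ.toFun (Icc γ.left γ.right) := ne_of_lt h

theorem arcLength_partialLength (h : γ.Rectifiable) {t : ℝ} (ht : t ∈ Icc γ.left γ.right) :
    γ.arcLength (γ.partialLength t) = γ.toFun t :=
  edist_eq_zero.1 (edist_naturalParameterization_eq_zero
    h.boundedVariationOn.locallyBoundedVariationOn γ.left_mem ht)

theorem partialLength_left : γ.partialLength γ.left = 0 := variationOnFromTo.self _ _ _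

theorem partialLength_right : γ.partialLength γ.right = γ.length.toReal := by
  rw [partialLength, variationOnFromTo.eq_of_le _ _ γ.left_le_right, inter_self, length]

/-- Partial length is continuous and monotone, so it takes every intermediate value; hence each
parameter in `[0, ℓ(γ)]` is a genuine arc length parameter. -/
theorem image_partialLength (h : γ.Rectifiable) :
    γ.partialLength '' Icc γ.left γ.right = Icc 0 γ.length.toReal := by
  have hm : MonotoneOn γ.partialLength (Icc γ.left γ.right) :=
    variationOnFromTo.monotoneOn h.boundedVariationOn.locallyBoundedVariationOn γ.left_mem
  apply Subset.antisymm
  · rintro _ ⟨t, ht, rfl⟩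
    rw [← partialLength_left (γ := γ), ← partialLength_right]
    exact ⟨hm γ.left_mem ht ht.1, hm ht γ.right_mem ht.2⟩
  · rw [← partialLength_left (γ := γ), ← partialLength_right]
    exact intermediate_value_Icc γ.left_le_right
      (continuousOn_variationOnFromTo γ.continuousOn h.boundedVariationOn γ.left_mem)

theorem exists_arcLength_eq (h : γ.Rectifiable) {s : ℝ} (hs : s ∈ Icc 0 γ.length.toReal) :
    ∃ t ∈ Icc γ.left γ.right, γ.partialLength t = s ∧ γ.arcLength s = γ.toFun t := by
  rw [← image_partialLength h] at hs
  obtain ⟨t, ht, rfl⟩ := hs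
  exact ⟨t, ht, rfl, arcLength_partialLength h ht⟩

theorem arcLength_zero (h : γ.Rectifiable) : γ.arcLength 0 = γ.source := by
  rw [← partialLength_left (γ := γ), arcLength_partialLength h γ.left_mem, source]

theorem arcLength_length (h : γ.Rectifiable) : γ.arcLength γ.length.toReal = γ.target := by
  rw [← partialLength_right (γ := γ), arcLength_partialLength h γ.right_mem, target]

theorem dist_arcLength_le (h : γ.Rectifiable) {s t : ℝ} (hs : 0 ≤ s) (hst : s ≤ t)
    (ht : t ≤ γ.length.toReal) : dist (γ.arcLength s) (γ.arcLength t) ≤ t - s := by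
  have hu := has_unit_speed_naturalParameterization γ.toFun
    h.boundedVariationOn.locallyBoundedVariationOn γ.left_mem
  change HasUnitSpeedOn γ.arcLength (γ.partialLength '' Icc γ.left γ.right) at hu
  rw [image_partialLength h] at hu
  have hs' : s ∈ Icc 0 γ.length.toReal := ⟨hs, hst.trans ht⟩
  have ht' : t ∈ Icc 0 γ.length.toReal := ⟨hs.trans hst, ht⟩
  have h1 := hu hs' ht'
  have h2 := eVariationOn.edist_le γ.arcLength (s := Icc 0 γ.length.toReal ∩ Icc s t)
    ⟨hs', le_rfl, hst⟩ ⟨ht', hst, le_rfl⟩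
  rw [h1, edist_dist, NNReal.coe_one, one_mul] at h2
  exact (ENNReal.ofReal_le_ofReal_iff (by linarith)).1 h2

theorem edist_le_length : edist γ.source γ.target ≤ γ.length :=
  eVariationOn.edist_le _ γ.left_mem γ.right_mem

theorem isAvoiding_arcLength (h : γ.Rectifiable) {E : Set Z}
    (hE : volume (Icc 0 γ.length.toReal ∩ γ.arcLength ⁻¹' E) = 0) :
    IsAvoiding E γ.arcLength γ.length.toReal :=
  ⟨ENNReal.toReal_nonneg, fun _ _ => dist_arcLength_le h, hE⟩

theorem avoidingPath (h : γ.Rectifiable) {E : Set Z}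
    (hE : volume (Icc 0 γ.length.toReal ∩ γ.arcLength ⁻¹' E) = 0) :
    AvoidingPath E γ.source γ.target γ.length.toReal :=
  ⟨_, isAvoiding_arcLength h hE, arcLength_zero h, arcLength_length h⟩

end Curve

/-- A path avoiding `E` yields a curve on `[0, 1]` along which functions vanishing off `E`
have integral zero. -/
theorem AvoidingPath.exists_curve {E : Set Z} {x y : Z} {L : ℝ} (h : AvoidingPath E x y L) :
    ∃ γ : Curve Z, γ.left = 0 ∧ γ.right = 1 ∧ γ.toFun 0 = x ∧ γ.toFun 1 = y ∧
      γ.length ≤ ENNReal.ofReal L ∧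
      ∀ ρ : Z → ℝ≥0∞, (∀ z ∉ E, ρ z = 0) → γ.integral ρ = 0 := by
  obtain ⟨σ, h, rfl, rfl⟩ := h
  have hL := h.nonneg
  have hlip : LipschitzOnWith L.toNNReal (fun t => σ (L * t)) (Icc 0 1) := by
    refine LipschitzOnWith.of_dist_le_mul fun s hs t ht => ?_
    rw [Real.coe_toNNReal L hL]
    wlog hst : s ≤ t generalizing s t
    · rw [dist_comm, dist_comm s t]
      exact this t ht s hs (le_of_not_ge hst)
    have := h.dist_le (L * s) (L * t) (mul_nonneg hL hs.1) (by gcongr) (by nlinarith [ht.2])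
    rw [dist_comm s t, Real.dist_eq, abs_of_nonneg (by linarith)]
    linarith
  have hvar : ∀ s ⊆ Icc (0 : ℝ) 1, ∀ a b : ℝ,
      eVariationOn (fun t => σ (L * t)) (s ∩ Icc a b) ≤ ENNReal.ofReal (L * (b - a)) := by
    intro s hs a b
    have := (hlip.mono (inter_subset_left.trans hs)).comp_eVariationOn_le
      (f := _) (g := id) (s := s ∩ Icc a b) (mapsTo_id _)
    refine this.trans ?_
    refine (mul_le_mul_right (eVariationOn.mono id inter_subset_right) _).trans ?_
    rw [eVariationOn_id_Icc, ENNReal.ofReal_mul hL]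
    exact le_rfl
  let γ : Curve Z := ⟨0, 1, zero_le_one, fun t => σ (L * t), hlip.continuousOn⟩
  have hlen : γ.length ≤ ENNReal.ofReal L := by
    have := hvar (Icc 0 1) Subset.rfl 0 1
    rwa [inter_self, sub_zero, mul_one] at this
  have hrect : γ.Rectifiable := hlen.trans_lt ENNReal.ofReal_lt_top
  refine ⟨γ, rfl, rfl, by simp [γ], by simp [γ], hlen, fun ρ hρ => ?_⟩
  -- Time at speed `σ` is turned into arc length by a `1`-Lipschitz map, and Lipschitz images of
  -- null sets of reals are null. The case `L = 0` is separate because of the division by `L`.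
  have hnull : volume (Icc 0 γ.length.toReal ∩ γ.arcLength ⁻¹' E) = 0 := by
    rcases hL.eq_or_lt with h0 | hpos
    · have : γ.length = 0 := by simpa [← h0] using hlen
      rw [this]
      exact measure_mono_null inter_subset_left (by simp)
    have hsub : Icc 0 γ.length.toReal ∩ γ.arcLength ⁻¹' E ⊆
        (fun τ => γ.partialLength (τ / L)) '' (Icc 0 L ∩ σ ⁻¹' E) := by
      rintro s ⟨hs, hsE⟩
      obtain ⟨t, ht, rfl, h2⟩ := Curve.exists_arcLength_eq hrect hs
      refine ⟨L * t, ⟨⟨mul_nonneg hL ht.1, ?_⟩, ?_⟩, ?_⟩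
      · calc L * t ≤ L * 1 := by gcongr; exact ht.2
          _ = L := mul_one L
      · rw [mem_preimage, h2] at hsE
        exact hsE
      · have : L * t / L = t := by field_simp
        simp only [this]
    have hl : LipschitzOnWith 1 (fun τ => γ.partialLength (τ / L)) (Icc 0 L ∩ σ ⁻¹' E) := by
      refine LipschitzOnWith.of_dist_le_mul fun s hs t ht => ?_
      rw [NNReal.coe_one, one_mul]
      wlog hst : s ≤ t generalizing s t
      · rw [dist_comm, dist_comm s t]
        exact this t ht s hs (le_of_not_ge hst)
      have ms : s / L ∈ Icc (0 : ℝ) 1 := ⟨div_nonneg hs.1.1 hL, (div_le_one hpos).2 hs.1.2⟩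
      have mt : t / L ∈ Icc (0 : ℝ) 1 := ⟨div_nonneg ht.1.1 hL, (div_le_one hpos).2 ht.1.2⟩
      have hle : s / L ≤ t / L := by gcongr
      rw [dist_comm, Real.dist_eq, Curve.partialLength, Curve.partialLength,
        variationOnFromTo.sub_right hrect.boundedVariationOn.locallyBoundedVariationOn
        γ.left_mem mt ms, variationOnFromTo.eq_of_le _ _ hle,
        abs_of_nonneg ENNReal.toReal_nonneg, dist_comm, Real.dist_eq, abs_of_nonneg (by linarith)]
      refine ENNReal.toReal_le_of_le_ofReal (by linarith) ?_
      refine (hvar (Icc 0 1) Subset.rfl _ _).trans_eq ?_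
      congr 1
      field_simp
    refine measure_mono_null hsub ?_
    have := hl.hausdorffMeasure_image_le (d := 1) zero_le_one
    rw [hausdorffMeasure_real, h.null, mul_zero] at this
    exact le_antisymm this zero_le
  rw [Curve.integral]
  have : ∀ᵐ s ∂(volume.restrict (Icc 0 γ.length.toReal)), ρ (γ.arcLength s) = 0 := by
    rw [ae_restrict_iff' measurableSet_Icc, ae_iff]
    refine measure_mono_null ?_ hnull
    intro s hs
    simp only [mem_ofPred_eq, Classical.not_imp] at hs
    exact ⟨hs.1, by_contra fun hE => hs.2 (hρ _ hE)⟩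
  rw [lintegral_congr_ae this, lintegral_zero]

end ArcLength

/-! ### Negligible families and null sets -/

section Negligible

theorem measure_ne_zero_of_essSup_eq_zero {Z : Type*} [MeasurableSpace Z] {μ : Measure Z}
    {ρ : Z → ℝ≥0∞} (h0 : essSup ρ μ = 0) : μ {z | ρ z ≠ 0} = 0 := by
  have := ENNReal.ae_le_essSup (μ := μ) ρ
  rw [h0, ae_iff] at this
  exact measure_mono_null (fun z hz => by simpa using hz) this

variable {Z : Type*} [MetricSpace Z]

/-- A curve avoids `E` if its arc length parametrization spends zero time in `E`. -/
def Curve.Avoids (γ : Curve Z) (E : Set Z) : Prop :=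
  volume (Icc 0 γ.length.toReal ∩ γ.arcLength ⁻¹' E) = 0

theorem Curve.Avoids.mono {γ : Curve Z} {E F : Set Z} (h : γ.Avoids F) (hEF : E ⊆ F) :
    γ.Avoids E :=
  measure_mono_null (inter_subset_inter_right _ (preimage_mono hEF)) h

theorem Curve.Avoids.ae {γ : Curve Z} {E : Set Z} (h : γ.Avoids E) :
    ∀ᵐ s ∂(volume.restrict (Icc 0 γ.length.toReal)), γ.arcLength s ∉ E := by
  rw [ae_restrict_iff' measurableSet_Icc, ae_iff]
  refine measure_mono_null ?_ h
  intro s hs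
  simp only [mem_ofPred_eq, Classical.not_imp, not_not] at hs
  exact hs

theorem Curve.Rectifiable.continuousOn_arcLength {γ : Curve Z} (h : γ.Rectifiable) :
    ContinuousOn γ.arcLength (Icc 0 γ.length.toReal) := by
  have : LipschitzOnWith 1 γ.arcLength (Icc 0 γ.length.toReal) := by
    refine LipschitzOnWith.of_dist_le_mul fun s hs t ht => ?_
    rw [NNReal.coe_one, one_mul]
    wlog hst : s ≤ t generalizing s t
    · rw [dist_comm, dist_comm s t]
      exact this t ht s hs (le_of_not_ge hst)
    rw [dist_comm s t, Real.dist_eq, abs_of_nonneg (by linarith)]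
    exact Curve.dist_arcLength_le h hs.1 hst ht.2
  exact this.continuousOn

variable [MeasurableSpace Z] {μ : Measure Z}

/-- One passes from `ρ` to the null set where it is nonzero, and from `E` to `∞` times its
indicator, whose integral along a curve is infinite as soon as the curve spends positive time in
`E`. -/
theorem negligible_iff [BorelSpace Z] {Γ : Set (Curve Z)} :
    Negligible μ Γ ↔ ∃ E, MeasurableSet E ∧ μ E = 0 ∧
      ∀ γ ∈ Γ, γ.Rectifiable → ¬ γ.Avoids E := by
  constructor
  · rintro ⟨ρ, hρ, h0, h⟩
    refine ⟨{z | ρ z ≠ 0}, hρ (measurableSet_singleton 0).compl,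
      measure_ne_zero_of_essSup_eq_zero h0, fun γ hγ hr ha => ?_⟩
    have h1 := h γ hγ hr
    rw [Curve.integral, lintegral_congr_ae (g := fun _ => 0)
      (ha.ae.mono fun s hs => by simpa using hs), lintegral_zero] at h1
    exact ENNReal.zero_ne_top h1
  · rintro ⟨E, hE, h0, h⟩
    refine ⟨E.indicator fun _ => ∞, measurable_const.indicator hE, ?_, fun γ hγ hr => ?_⟩
    · have : E.indicator (fun _ => (∞ : ℝ≥0∞)) =ᵐ[μ] fun _ => 0 := by
        have := (measure_eq_zero_iff_ae_notMem (s := E)).1 h0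
        filter_upwards [this] with z hz using indicator_of_notMem hz _
      rw [essSup_congr_ae this]
      exact le_antisymm (essSup_le_of_ae_le _ (Eventually.of_forall fun _ => le_rfl)) zero_le
    · by_contra hlt
      refine h γ hγ hr ?_
      have hm : AEMeasurable (fun s => E.indicator (fun _ => (∞ : ℝ≥0∞)) (γ.arcLength s))
          (volume.restrict (Icc 0 γ.length.toReal)) :=
        (measurable_const.indicator hE).comp_aemeasurable
          (hr.continuousOn_arcLength.aemeasurable measurableSet_Icc)
      have := ae_lt_top' hm hlt
      rw [ae_restrict_iff' measurableSet_Icc, ae_iff] at this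
      refine measure_mono_null ?_ this
      rintro s ⟨hs, hsE⟩
      simp only [mem_ofPred_eq, Classical.not_imp]
      refine ⟨hs, ?_⟩
      rw [mem_preimage] at hsE
      simp [hsE]

theorem newtonEnergy_le_of_const {u : Z → ℝ} {L : ℝ≥0}
    (h : IsWeakUpperGradient μ u fun _ => L) : newtonEnergy μ u ≤ L := by
  have h1 : essSup (fun _ : Z => (L : ℝ≥0∞)) μ ≤ L :=
    essSup_le_of_ae_le _ (Eventually.of_forall fun _ => le_rfl)
  exact iInf₂_le_of_le _ ⟨h, h1.trans_lt ENNReal.coe_lt_top⟩ h1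

theorem mem_newtonSobolev_of_const {u : Z → ℝ} {L : ℝ≥0} {M : ℝ} (hu : AEStronglyMeasurable u μ)
    (hM : ∀ x, |u x| ≤ M) (h : IsWeakUpperGradient μ u fun _ => L) : u ∈ NewtonSobolev μ := by
  refine ⟨memLp_top_of_bound hu M (Eventually.of_forall hM), _, h, ?_⟩
  exact (essSup_le_of_ae_le _ (Eventually.of_forall fun _ => le_rfl)).trans_lt
    (ENNReal.coe_lt_top (r := L))

theorem abs_le_of_ae_le [μ.IsOpenPosMeasure] {f : Z → ℝ} (hf : Continuous f) {M : ℝ}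
    (h : ∀ᵐ x ∂μ, |f x| ≤ M) (x : Z) : |f x| ≤ M := by
  by_contra hn
  have ho : IsOpen {z | M < |f z|} := isOpen_lt continuous_const hf.abs
  refine (ho.measure_pos μ ⟨x, not_le.1 hn⟩).ne' ?_
  rw [ae_iff] at h
  simpa using h

variable [BorelSpace Z]

/-- Along curves avoiding a suitable null set and contained in `S`, the upper gradient inequality
holds with the essential supremum over `S`. -/
theorem IsWeakUpperGradient.exists_null {u : Z → ℝ} {ρ : Z → ℝ≥0∞}
    (h : IsWeakUpperGradient μ u ρ) {S : Set Z} (hS : MeasurableSet S) :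
    ∃ E, MeasurableSet E ∧ μ E = 0 ∧ ∀ γ : Curve Z, γ.Rectifiable → γ.Avoids E →
      (∀ s ∈ Icc 0 γ.length.toReal, γ.arcLength s ∈ S) →
      ENNReal.ofReal |u γ.source - u γ.target| ≤ essSup ρ (μ.restrict S) * γ.length := by
  obtain ⟨E, hE, h0, hE'⟩ := negligible_iff.1 h.2
  have h1 : μ (S ∩ {z | essSup ρ (μ.restrict S) < ρ z}) = 0 := by
    have := ENNReal.ae_le_essSup (μ := μ.restrict S) ρ
    rw [ae_restrict_iff' hS, ae_iff] at this
    refine measure_mono_null ?_ this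
    rintro z ⟨hz, hz'⟩
    simp only [mem_ofPred_eq, Classical.not_imp, not_le]
    exact ⟨hz, hz'⟩
  -- Two things must be avoided: the set carrying the exceptional curves, and the part of `S` where
  -- `ρ` exceeds its essential supremum.
  refine ⟨E ∪ (S ∩ {z | essSup ρ (μ.restrict S) < ρ z}), hE.union (hS.inter
    (measurableSet_lt measurable_const h.1)), measure_union_null h0 h1, fun γ hr ha hγS => ?_⟩
  by_cases hc : γ.IsConstant
  · have : γ.source = γ.target := hc _ γ.left_mem _ γ.right_mem
    simp [this]
  have h2 : ENNReal.ofReal |u γ.source - u γ.target| ≤ γ.integral ρ := by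
    by_contra hn
    exact hE' γ ⟨hc, hn⟩ hr (ha.mono subset_union_left)
  refine h2.trans ?_
  rw [Curve.integral]
  have h3 : ∀ᵐ s ∂(volume.restrict (Icc 0 γ.length.toReal)),
      ρ (γ.arcLength s) ≤ essSup ρ (μ.restrict S) := by
    filter_upwards [(ha.mono subset_union_right).ae, ae_restrict_mem measurableSet_Icc] with s hs hs'
    by_contra hn
    exact hs ⟨hγS s hs', not_le.1 hn⟩
  refine (lintegral_mono_ae h3).trans ?_
  rw [lintegral_const, Measure.restrict_apply_univ, Real.volume_Icc, sub_zero,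
    ENNReal.ofReal_toReal (ne_of_lt hr)]

theorem isWeakUpperGradient_const {u : Z → ℝ} {L : ℝ≥0} {E : Set Z} (hE : MeasurableSet E)
    (h0 : μ E = 0) (h : ∀ γ : Curve Z, γ.Rectifiable → γ.Avoids E →
      |u γ.source - u γ.target| ≤ L * γ.length.toReal) :
    IsWeakUpperGradient μ u fun _ => L := by
  refine ⟨measurable_const, negligible_iff.2 ⟨E, hE, h0, fun γ hγ hr ha => hγ.2 ?_⟩⟩
  refine (ENNReal.ofReal_le_ofReal (h γ hr ha)).trans ?_
  rw [Curve.integral, lintegral_const, Measure.restrict_apply_univ, Real.volume_Icc, sub_zero,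
    ENNReal.ofReal_mul L.coe_nonneg, ENNReal.ofReal_coe_nnreal]

theorem isWeakUpperGradient_of_lipschitzWith {u : Z → ℝ} {L : ℝ≥0} (h : LipschitzWith L u) :
    IsWeakUpperGradient μ u fun _ => L := by
  refine isWeakUpperGradient_const (E := ∅) MeasurableSet.empty measure_empty fun γ hr _ => ?_
  rw [← Real.dist_eq]
  refine (h.dist_le_mul _ _).trans ?_
  gcongr
  rw [dist_edist]
  exact ENNReal.toReal_mono (ne_of_lt hr) Curve.edist_le_length

end Negligible

/-! ### Thick quasiconvexity in terms of null sets -/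

section Thick

variable {Z : Type*} [MetricSpace Z] [MeasurableSpace Z] {μ : Measure Z} {C : ℝ≥0}

/-- A function witnessing negligibility vanishes off a null set, so its integral is zero, not
infinite, along a path avoiding that set. -/
theorem veryThickQuasiconvex_of_avoidingPath
    (h : ∀ E, MeasurableSet E → μ E = 0 → ∀ x y : Z, ∃ L ≤ C * dist x y, AvoidingPath E x y L) :
    VeryThickQuasiconvex μ C ∞ := by
  rintro - x - y - ⟨ρ, hρ, h0, hn⟩
  obtain ⟨L, hL, hp⟩ := h _ (hρ (measurableSet_singleton 0).compl)
    (measure_ne_zero_of_essSup_eq_zero h0) x y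
  obtain ⟨γ, h1, h2, h3, h4, h5, h6⟩ := hp.exists_curve
  have h7 : γ.length ≤ C * edist x y := by
    refine h5.trans ((ENNReal.ofReal_le_ofReal hL).trans_eq ?_)
    rw [ENNReal.ofReal_mul C.coe_nonneg, ENNReal.ofReal_coe_nnreal, edist_dist]
  have h8 := hn γ ⟨h1, h2, h3, h4, h7⟩ (h5.trans_lt ENNReal.ofReal_lt_top)
  rw [h6 ρ fun z hz => by simpa using hz] at h8
  exact ENNReal.zero_ne_top h8

variable [BorelSpace Z]

theorem VeryThickQuasiconvex.exists_curve (h : VeryThickQuasiconvex μ C ∞) {E : Set Z}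
    (hE : MeasurableSet E) (h0 : μ E = 0) (x y : Z) :
    ∃ γ : Curve Z, γ.Rectifiable ∧ γ.Avoids E ∧ γ.source = x ∧ γ.target = y ∧
      γ.length ≤ C * edist x y := by
  have h1 := h x x (by simp) y (by simp)
  rw [negligible_iff] at h1
  push Not at h1
  obtain ⟨γ, ⟨hl, hr, hx, hy, hlen⟩, hrect, ha⟩ := h1 E hE h0
  exact ⟨γ, hrect, ha, by rw [Curve.source, hl, hx], by rw [Curve.target, hr, hy], hlen⟩

theorem VeryThickQuasiconvex.quasiconvex (h : VeryThickQuasiconvex μ C ∞) : Quasiconvex Z C :=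
  fun x y => by
    obtain ⟨γ, h1, -, h2⟩ := h.exists_curve MeasurableSet.empty measure_empty x y
    exact ⟨γ, h1, h2⟩

/-- Thickness provides a curve that avoids the null set of `exists_null`; its length bound keeps it
within `C d(x,y)` of `x`, hence in `S`. Taking `S` to be the whole space gives Lipschitz bounds, a
ball gives the Poincaré inequality. -/
theorem VeryThickQuasiconvex.edist_le (h : VeryThickQuasiconvex μ C ∞) {u : Z → ℝ}
    {ρ : Z → ℝ≥0∞} (hρ : IsWeakUpperGradient μ u ρ) {S : Set Z} (hS : MeasurableSet S) {x y : Z}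
    (hxy : ∀ z, dist x z ≤ C * dist x y → z ∈ S) :
    edist (u x) (u y) ≤ C * edist x y * essSup ρ (μ.restrict S) := by
  obtain ⟨E, hE, h0, h1⟩ := hρ.exists_null hS
  obtain ⟨γ, hr, ha, rfl, rfl, hl⟩ := h.exists_curve hE h0 x y
  rw [edist_dist, Real.dist_eq]
  refine (h1 γ hr ha fun s hs => hxy _ ?_).trans ?_
  · rw [← Curve.arcLength_zero hr]
    refine (Curve.dist_arcLength_le hr le_rfl hs.1 hs.2).trans ?_
    rw [sub_zero, Curve.arcLength_zero hr]
    refine hs.2.trans (ENNReal.toReal_le_of_le_ofReal (by positivity) (hl.trans_eq ?_))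
    rw [ENNReal.ofReal_mul C.coe_nonneg, ENNReal.ofReal_coe_nnreal, edist_dist]
  · rw [mul_comm]
    gcongr

theorem VeryThickQuasiconvex.lipschitzWith (h : VeryThickQuasiconvex μ C ∞) {u : Z → ℝ}
    {ρ : Z → ℝ≥0∞} (hρ : IsWeakUpperGradient μ u ρ) (hb : essSup ρ μ < ∞) :
    LipschitzWith (C * (essSup ρ μ).toNNReal) u := by
  intro x y
  have := h.edist_le hρ MeasurableSet.univ (x := x) (y := y) fun _ _ => mem_univ _
  rw [Measure.restrict_univ] at this
  rw [ENNReal.coe_mul, ENNReal.coe_toNNReal hb.ne]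
  refine this.trans_eq ?_
  ring

/-- The function itself, not merely its class, is Lipschitz; by continuity its essential bound then
holds everywhere. -/
theorem VeryThickQuasiconvex.mem_boundedLipschitz [μ.IsOpenPosMeasure]
    (h : VeryThickQuasiconvex μ C ∞) {u : Z → ℝ} (hu : u ∈ NewtonSobolev μ) :
    u ∈ BoundedLipschitz Z := by
  obtain ⟨hm, ρ, hρ, hb⟩ := hu
  have hl := h.lipschitzWith hρ hb
  refine ⟨⟨_, hl⟩, (eLpNorm u ∞ μ).toReal, abs_le_of_ae_le (μ := μ) hl.continuous ?_⟩
  rw [eLpNorm_exponent_top]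
  filter_upwards [ae_le_eLpNormEssSup (f := u) (μ := μ)] with x hx
  have h1 : eLpNormEssSup u μ ≠ ∞ := by
    rw [← eLpNorm_exponent_top]
    exact hm.2.ne
  have := ENNReal.toReal_mono h1 hx
  simpa using this

theorem BoundedLipschitz.mem_newtonSobolev {f : Z → ℝ} (hf : f ∈ BoundedLipschitz Z) :
    f ∈ NewtonSobolev μ := by
  obtain ⟨⟨L, hL⟩, M, hM⟩ := hf
  exact mem_newtonSobolev_of_const hL.continuous.aestronglyMeasurable hM (isWeakUpperGradient_of_lipschitzWith hL)

theorem lipSpace_subset_sobolev : lipSpace μ ⊆ sobolev μ :=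
  fun _ ⟨f, hf, hu⟩ => ⟨f, BoundedLipschitz.mem_newtonSobolev hf, hu⟩

theorem sobolevEnergy_le_lipEnergy (u : Lp ℝ ∞ μ) : sobolevEnergy μ u ≤ lipEnergy μ u := by
  refine le_iInf₂ fun f hf => le_iInf₂ fun L hL => ?_
  exact iInf₂_le_of_le f ⟨BoundedLipschitz.mem_newtonSobolev hf.1, hf.2⟩
    (newtonEnergy_le_of_const (isWeakUpperGradient_of_lipschitzWith hL))

theorem VeryThickQuasiconvex.lipEnergy_le [μ.IsOpenPosMeasure] (h : VeryThickQuasiconvex μ C ∞)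
    (hC : 1 ≤ C) (u : Lp ℝ ∞ μ) : lipEnergy μ u ≤ C * sobolevEnergy μ u := by
  have hC0 : (C : ℝ≥0∞) ≠ 0 := ENNReal.coe_ne_zero.2 (zero_lt_one.trans_le hC).ne'
  -- With `C` moved to the left, the infima can be tested one representative and one gradient at a
  -- time.
  rw [← ENNReal.div_le_iff' hC0 ENNReal.coe_ne_top]
  refine le_iInf₂ fun v hv => le_iInf₂ fun ρ hρ => ?_
  rw [ENNReal.div_le_iff' hC0 ENNReal.coe_ne_top]
  have h1 : lipEnergy μ u ≤ lipConst v := iInf₂_le v ⟨h.mem_boundedLipschitz hv.1, hv.2⟩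
  have h2 : lipConst v ≤ (C * (essSup ρ μ).toNNReal : ℝ≥0) :=
    iInf₂_le (f := fun (L : ℝ≥0) (_ : LipschitzWith L v) => (L : ℝ≥0∞)) _
      (h.lipschitzWith hρ.1 hρ.2)
  refine h1.trans (h2.trans_eq ?_)
  rw [ENNReal.coe_mul, ENNReal.coe_toNNReal hρ.2.ne]

theorem VeryThickQuasiconvex.lipSpace_eq [μ.IsOpenPosMeasure] (h : VeryThickQuasiconvex μ C ∞) :
    lipSpace μ = sobolev μ :=
  lipSpace_subset_sobolev.antisymm fun _ ⟨v, hv, hu⟩ => ⟨v, h.mem_boundedLipschitz hv, hu⟩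

theorem VeryThickQuasiconvex.condition3 [μ.IsOpenPosMeasure] (h : VeryThickQuasiconvex μ C ∞)
    (hC : 1 ≤ C) : Condition3 μ C := by
  refine ⟨h.lipSpace_eq, fun u _ => ⟨h.lipEnergy_le hC u, (sobolevEnergy_le_lipEnergy u).trans ?_⟩⟩
  exact le_mul_of_one_le_left zero_le (ENNReal.one_le_coe_iff.2 hC)

theorem VeryThickQuasiconvex.condition1 [μ.IsOpenPosMeasure] (h : VeryThickQuasiconvex μ C ∞)
    (hC : 1 ≤ C) : Condition1 μ C⁻¹ C := by
  refine ⟨h.lipSpace_eq, fun u _ => ⟨?_, add_le_add_right (sobolevEnergy_le_lipEnergy u) _⟩,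
    h.quasiconvex⟩
  have hC0 : C ≠ 0 := (zero_lt_one.trans_le hC).ne'
  rw [ENNReal.coe_inv hC0, ENNReal.inv_mul_le_iff (ENNReal.coe_ne_zero.2 hC0) ENNReal.coe_ne_top,
    lipNorm, sobolevNorm, mul_add]
  exact add_le_add (le_mul_of_one_le_left zero_le (ENNReal.one_le_coe_iff.2 hC)) (h.lipEnergy_le hC u)

/-- The pointwise estimate bounds the oscillation of `u` on the ball, hence its mean deviation.
Points of the ball are less than `2r` apart, so the joining curves stay within `r + 2Cr` of the
centre. -/
theorem VeryThickQuasiconvex.weakPoincare (h : VeryThickQuasiconvex μ C ∞)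
    (hC : 1 ≤ C) (hpos : ∀ (z : Z) (r : ℝ), 0 < r → 0 < μ (Metric.ball z r))
    (hfin : ∀ (z : Z) (r : ℝ), 0 < r → μ (Metric.ball z r) < ∞) :
    WeakPoincare μ C (1 + 2 * C) := by
  intro x r hr u hu ρ hρ
  set B := Metric.ball x r with hB
  set S := Metric.ball x (((1 + 2 * C : ℝ≥0) : ℝ) * r) with hS
  have hBS : B ⊆ S := Metric.ball_subset_ball (by
    push_cast
    nlinarith [mul_nonneg C.coe_nonneg hr.le])
  set A := ⨍ w in B, u w ∂μ
  have hBm : MeasurableSet B := measurableSet_ball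
  have hB0 : μ B ≠ 0 := (hpos x r hr).ne'
  have hB1 : μ B ≠ ∞ := (hfin x r hr).ne
  have hBr : 0 < μ.real B := ENNReal.toReal_pos hB0 hB1
  have : IsFiniteMeasure (μ.restrict B) := ⟨by simpa using hfin x r hr⟩
  have : NeZero (μ.restrict B) := ⟨by simpa using hB0⟩
  have hui : IntegrableOn u B μ := hu B Metric.isBounded_ball
  set D := C * Metric.ediam B * essSup ρ (μ.restrict S) with hD
  have key : ∀ z ∈ B, ∀ w ∈ B, edist (u z) (u w) ≤ D := by
    intro z hz w hw
    refine (h.edist_le hρ (measurableSet_ball (x := x)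
      (ε := ((1 + 2 * C : ℝ≥0) : ℝ) * r)) (x := z) (y := w) ?_).trans ?_
    · intro q hq
      have h1 : dist z w < 2 * r := by
        have := dist_triangle_right z w x
        rw [Metric.mem_ball] at hz hw
        linarith
      rw [Metric.mem_ball] at hz ⊢
      have h2 := dist_triangle_left q x z
      have h3 : (0 : ℝ) < C := zero_lt_one.trans_le hC
      push_cast
      nlinarith
    · rw [hD]
      gcongr
      exact Metric.edist_le_ediam_of_mem hz hw
  -- The gradient need not be essentially bounded on `S`; in that case the right-hand side may be
  -- infinite.
  by_cases hDt : D = ∞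
  · rw [hDt]
    exact le_top
  have key' : ∀ z ∈ B, |u z - A| ≤ D.toReal := by
    intro z hz
    have h1 : u z - A = ⨍ w in B, (u z - u w) ∂μ := by
      have h2 : A = (μ.real B)⁻¹ * ∫ w in B, u w ∂μ := by
        rw [← smul_eq_mul, ← measureReal_restrict_apply_univ, ← average_eq]
      rw [average_eq, integral_sub (integrable_const _) hui, integral_const, h2,
        measureReal_restrict_apply_univ, smul_eq_mul, smul_eq_mul]
      field_simp
    rw [h1, ← Real.norm_eq_abs, average_eq, norm_smul, norm_inv,
      Real.norm_of_nonneg measureReal_nonneg]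
    rw [measureReal_restrict_apply_univ, inv_mul_le_iff₀ hBr, mul_comm]
    refine norm_setIntegral_le_of_norm_le_const hB1.lt_top fun w hw => ?_
    rw [← dist_eq_norm, dist_edist]
    exact ENNReal.toReal_mono hDt (key z hz w hw)
  refine ENNReal.ofReal_le_of_le_toReal ?_
  rw [average_eq, smul_eq_mul, measureReal_restrict_apply_univ,
    inv_mul_le_iff₀ hBr, mul_comm]
  refine (le_abs_self _).trans ?_
  rw [← Real.norm_eq_abs]
  refine norm_setIntegral_le_of_norm_le_const hB1.lt_top fun w hw => ?_
  rw [Real.norm_eq_abs, abs_abs]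
  exact key' w hw

end Thick

/-! ### Analytic sets are universally measurable -/

section Analytic

/-- An open set containing a box `∏ {0, …, m i}` of the Baire space contains a finite-dimensional
neighbourhood of that box. -/
theorem exists_cylinder_subset {m : ℕ → ℕ} {V : Set (ℕ → ℕ)} (hV : IsOpen V)
    (hm : {σ : ℕ → ℕ | ∀ i, σ i ≤ m i} ⊆ V) :
    ∃ k, {σ : ℕ → ℕ | ∀ i < k, σ i ≤ m i} ⊆ V := by
  by_contra! hn
  have : ∀ k, ∃ σ : ℕ → ℕ, (∀ i < k, σ i ≤ m i) ∧ σ ∉ V := fun k => by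
    obtain ⟨σ, h1, h2⟩ := not_subset.1 (hn k)
    exact ⟨σ, h1, h2⟩
  choose σ h1 h2 using this
  have hK : IsCompact (Set.pi univ fun i => Iic (m i)) :=
    isCompact_univ_pi fun i => (finite_Iic (m i)).isCompact
  -- Truncation puts the counterexamples in a compact box. It leaves the first `k` coordinates of `σ
  -- k` unchanged, so the original sequence has the same limit along `φ`.
  obtain ⟨τ, hτ, φ, hφ, hlim⟩ := hK.tendsto_subseq (x := fun k i => min (σ k i) (m i))
    fun k i _ => mem_Iic.2 (min_le_right _ _)
  have hlim' : Tendsto (fun k => σ (φ k)) atTop (𝓝 τ) := by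
    rw [tendsto_pi_nhds] at hlim ⊢
    intro i
    refine (hlim i).congr' ?_
    filter_upwards [eventually_gt_atTop i] with k hk
    exact min_eq_left (h1 (φ k) i (hk.trans_le hφ.le_apply))
  have hτV : τ ∈ V := hm fun i => hτ i (mem_univ i)
  obtain ⟨k, hk⟩ := (hlim'.eventually (hV.mem_nhds hτV)).exists
  exact h2 _ hk

/-- Capacitability: the coordinates of the Baire space are bounded one after another, losing so
little that the image keeps outer measure above `c`; continuity from below holds for arbitrary sets.
All the bounds together define a compact box. Any open set containing its image contains the image
of some finite stage, so outer regularity gives measure at least `c`. -/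
theorem exists_isCompact_subset_of_analyticSet {α : Type*} [TopologicalSpace α]
    [MeasurableSpace α] {μ : Measure α} [μ.OuterRegular] {s : Set α}
    (hs : AnalyticSet s) {c : ℝ≥0∞} (hc : c < μ s) : ∃ K ⊆ s, IsCompact K ∧ c ≤ μ K := by
  rw [AnalyticSet] at hs
  rcases hs with rfl | ⟨f, hf, rfl⟩
  · simp at hc
  have step : ∀ (k : ℕ) (A : Set (ℕ → ℕ)), c < μ (f '' A) →
      ∃ m, c < μ (f '' (A ∩ {σ | σ k ≤ m})) := by
    intro k A hA
    have h1 : f '' A = ⋃ m, f '' (A ∩ {σ | σ k ≤ m}) := by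
      rw [← image_iUnion, ← inter_iUnion]
      congr 1
      refine (inter_eq_left.2 fun σ _ => mem_iUnion.2 ⟨σ k, le_refl (σ k)⟩).symm
    have h2 : Monotone fun m => f '' (A ∩ {σ | σ k ≤ m}) := fun m n hmn =>
      image_mono (inter_subset_inter_right _ fun σ hσ => le_trans hσ hmn)
    rw [h1, h2.measure_iUnion] at hA
    exact lt_iSup_iff.1 hA
  choose! next hnext using step
  let A : ℕ → Set (ℕ → ℕ) := fun n =>
    Nat.rec univ (fun k B => B ∩ {σ | σ k ≤ next k B}) n
  have hA : ∀ k, c < μ (f '' A k) := by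
    intro k
    induction k with
    | zero => simpa [A] using hc
    | succ k ih => exact hnext k _ ih
  set m : ℕ → ℕ := fun k => next k (A k)
  have hAm : ∀ k, A k = {σ | ∀ i < k, σ i ≤ m i} := by
    intro k
    induction k with
    | zero => simp [A]
    | succ k ih =>
      have : A (k + 1) = A k ∩ {σ | σ k ≤ m k} := rfl
      rw [this, ih]
      ext σ
      simp only [mem_inter_iff, mem_ofPred_eq, Nat.lt_succ_iff_lt_or_eq, or_imp, forall_and, forall_eq]
  have hK : IsCompact {σ : ℕ → ℕ | ∀ i, σ i ≤ m i} := by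
    have : IsCompact (Set.pi univ fun i => Iic (m i)) :=
      isCompact_univ_pi fun i => (finite_Iic (m i)).isCompact
    convert this using 1
    ext σ
    simp only [mem_ofPred_eq, Set.mem_pi, mem_univ, mem_Iic, true_imp_iff]
  refine ⟨f '' {σ | ∀ i, σ i ≤ m i}, image_subset_range _ _, hK.image hf, ?_⟩
  rw [Set.measure_eq_iInf_isOpen]
  refine le_iInf₂ fun U hU => le_iInf fun hUo => ?_
  obtain ⟨k, hk⟩ := exists_cylinder_subset (hUo.preimage hf) (image_subset_iff.1 hU)
  refine (hA k).le.trans (measure_mono ?_)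
  rw [hAm k, image_subset_iff]
  exact hk

/-- For an equivalent finite measure, countably many compact subsets exhaust the measure of `s`. -/
theorem nullMeasurableSet_of_analyticSet {α : Type*} [TopologicalSpace α]
    [TopologicalSpace.PseudoMetrizableSpace α] [T2Space α] [MeasurableSpace α] [BorelSpace α]
    {μ : Measure α} [SFinite μ] {s : Set α} (hs : AnalyticSet s) : NullMeasurableSet s μ := by
  refine NullMeasurableSet.mono_ac ?_ (absolutelyContinuous_toFinite μ)
  set ν := μ.toFinite
  rcases eq_or_ne (ν s) 0 with h0 | h0
  · exact NullMeasurableSet.of_null h0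
  obtain ⟨c, -, hc, hlim⟩ := exists_seq_strictMono_tendsto' (pos_iff_ne_zero.2 h0)
  choose K hKs hK hcK using fun n => exists_isCompact_subset_of_analyticSet hs (hc n).2
  have hle : ν s ≤ ν (⋃ n, K n) :=
    le_of_tendsto' hlim fun n => (hcK n).trans (measure_mono (subset_iUnion K n))
  have hm : MeasurableSet (⋃ n, K n) := MeasurableSet.iUnion fun n => (hK n).measurableSet
  exact hm.nullMeasurableSet.congr (ae_eq_of_subset_of_measure_ge (iUnion_subset hKs) hle
    hm.nullMeasurableSet (measure_ne_top ν s))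

end Analytic

/-! ### Locally complete spaces -/

section Polish

/-- A complete neighbourhood is closed in the completion, while `Z` is dense in every ball there; so
a small ball of the completion lies entirely in that neighbourhood. -/
theorem LocallyComplete.isOpen_range_coe {Z : Type*} [MetricSpace Z] (h : LocallyComplete Z) :
    IsOpen (range ((↑) : Z → UniformSpace.Completion Z)) := by
  rw [isOpen_iff_mem_nhds]
  rintro _ ⟨z, rfl⟩
  obtain ⟨s, hs, hc⟩ := h z
  obtain ⟨r, hr, hrs⟩ := Metric.mem_nhds_iff.1 hs
  refine Filter.mem_of_superset (Metric.ball_mem_nhds _ hr) ?_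
  have hcl : IsClosed ((↑) '' s : Set (UniformSpace.Completion Z)) :=
    ((UniformSpace.Completion.isUniformInducing_coe Z).isComplete_iff.2 hc).isClosed
  refine (UniformSpace.Completion.denseRange_coe.open_subset_closure_inter
    Metric.isOpen_ball).trans ?_
  refine (closure_minimal ?_ hcl).trans (image_subset_range _ _)
  rintro _ ⟨hw, w, rfl⟩
  refine ⟨w, hrs ?_, rfl⟩
  rwa [Metric.mem_ball, UniformSpace.Completion.dist_eq] at hw

theorem LocallyComplete.polishSpace {Z : Type*} [MetricSpace Z]
    [TopologicalSpace.SeparableSpace Z] (h : LocallyComplete Z) : PolishSpace Z := by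
  have : SecondCountableTopology (UniformSpace.Completion Z) :=
    UniformSpace.secondCountable_of_separable _
  have : PolishSpace (range ((↑) : Z → UniformSpace.Completion Z)) :=
    h.isOpen_range_coe.polishSpace
  exact (UniformSpace.Completion.coe_isometry
    (α := Z)).isEmbedding.toHomeomorph.isClosedEmbedding.polishSpace

theorem polishSpace_continuousMap {X Y : Type*} [TopologicalSpace X] [CompactSpace X]
    [LocallyCompactSpace X] [SecondCountableTopology X] [TopologicalSpace Y] [PolishSpace Y] :
    PolishSpace C(X, Y) := by
  let _ := TopologicalSpace.upgradeIsCompletelyMetrizable Y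
  have : SecondCountableTopology C(X, Y) := inferInstance
  infer_instance

end Polish

/-! ### The truncated path distance from an open set -/

section PathDist

variable {Z : Type*} [MetricSpace Z]

/-- The infimal length, truncated at `M`, of paths from `A` to `z` that avoid `E`. -/
def pathDist (E A : Set Z) (M : ℝ) (z : Z) : ℝ :=
  sInf (insert M {L | ∃ a ∈ A, AvoidingPath E a z L})

variable {E A : Set Z} {M : ℝ}

theorem bddBelow_pathDist (z : Z) (hM : 0 ≤ M) :
    0 ∈ lowerBounds (insert M {L | ∃ a ∈ A, AvoidingPath E a z L}) := by
  rintro L (rfl | ⟨a, -, h⟩)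
  · exact hM
  · exact h.nonneg

theorem pathDist_nonneg (hM : 0 ≤ M) (z : Z) : 0 ≤ pathDist E A M z :=
  le_csInf (insert_nonempty _ _) (bddBelow_pathDist z hM)

theorem pathDist_le (hM : 0 ≤ M) (z : Z) : pathDist E A M z ≤ M :=
  csInf_le ⟨0, bddBelow_pathDist z hM⟩ (mem_insert _ _)

theorem pathDist_le_of_path (hM : 0 ≤ M) {a z : Z} (ha : a ∈ A) {L : ℝ}
    (h : AvoidingPath E a z L) : pathDist E A M z ≤ L :=
  csInf_le ⟨0, bddBelow_pathDist z hM⟩ (mem_insert_of_mem _ ⟨a, ha, h⟩)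

theorem pathDist_eq_zero (hM : 0 ≤ M) {a : Z} (ha : a ∈ A) : pathDist E A M a = 0 :=
  (pathDist_le_of_path hM ha (AvoidingPath.refl E a)).antisymm (pathDist_nonneg hM a)

theorem exists_path_of_pathDist_lt {z : Z} {t : ℝ} (h : pathDist E A M z < t) (ht : t ≤ M) :
    ∃ L < t, ∃ a ∈ A, AvoidingPath E a z L := by
  obtain ⟨L, hL, hLt⟩ := exists_lt_of_csInf_lt (insert_nonempty _ _) h
  rcases hL with rfl | hL
  · exact absurd hLt (not_lt.2 ht)
  · exact ⟨L, hLt, hL⟩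

theorem pathDist_le_add (hM : 0 ≤ M) {p q : Z} {L : ℝ} (h : AvoidingPath E p q L) :
    pathDist E A M q ≤ pathDist E A M p + L := by
  rw [← sub_le_iff_le_add]
  refine le_csInf (insert_nonempty _ _) ?_
  rintro K (rfl | ⟨a, ha, hK⟩)
  · linarith [pathDist_le (E := E) (A := A) hM q, h.nonneg]
  · linarith [pathDist_le_of_path hM ha (hK.trans h)]

theorem abs_pathDist_sub_le (hM : 0 ≤ M) {p q : Z} {L : ℝ} (h : AvoidingPath E p q L) :
    |pathDist E A M p - pathDist E A M q| ≤ L :=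
  abs_sub_le_iff.2 ⟨by linarith [pathDist_le_add (A := A) hM h.symm],
    by linarith [pathDist_le_add (A := A) hM h]⟩

/-- Rescaling to the unit interval places all paths in one Polish space of continuous maps, where
the conditions become Borel. -/
theorem avoidingPath_iff_exists_continuousMap {a z : Z} {q : ℝ} (hq : 0 < q) :
    AvoidingPath E a z q ↔ ∃ g : C(unitInterval, Z), g 0 = a ∧ g 1 = z ∧
      (∀ s t, dist (g s) (g t) ≤ q * dist s t) ∧
      volume.restrict (Icc 0 1) {t : ℝ | g (projIcc 0 1 zero_le_one t) ∈ E} = 0 := by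
  constructor
  · rintro ⟨σ, h, rfl, rfl⟩
    have hd : ∀ s t : unitInterval, dist (σ (q * s)) (σ (q * t)) ≤ q * dist s t := by
      intro s t
      wlog hst : s ≤ t generalizing s t
      · rw [dist_comm, dist_comm s t]
        exact this t s (le_of_not_ge hst)
      have hst' : (s : ℝ) ≤ t := hst
      rw [dist_comm s t, Subtype.dist_eq, Real.dist_eq, abs_of_nonneg (by linarith), mul_sub]
      exact h.dist_le _ _ (mul_nonneg hq.le s.2.1) (by gcongr) (by nlinarith [t.2.2])
    have hc : LipschitzWith q.toNNReal fun t : unitInterval => σ (q * t) :=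
      LipschitzWith.of_dist_le_mul fun s t => by
        rw [Real.coe_toNNReal q hq.le]
        exact hd s t
    refine ⟨⟨_, hc.continuous⟩, by simp, by simp, hd, ?_⟩
    rw [Measure.restrict_apply' measurableSet_Icc]
    have : volume ((fun t => q * t) ⁻¹' (Icc 0 q ∩ σ ⁻¹' E)) = 0 := by
      rw [Real.volume_preimage_mul_left hq.ne', h.null, mul_zero]
    refine measure_mono_null ?_ this
    rintro t ⟨htE, ht⟩
    simp only [mem_ofPred_eq, ContinuousMap.coe_mk, projIcc_of_mem zero_le_one ht] at htE
    exact ⟨⟨mul_nonneg hq.le ht.1, by nlinarith [ht.2]⟩, htE⟩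
  · rintro ⟨g, rfl, rfl, hd, h0⟩
    refine ⟨fun t => g (projIcc 0 1 zero_le_one (t / q)), ⟨hq.le, fun s t hs hst ht => ?_, ?_⟩,
      ?_, ?_⟩
    · refine (hd _ _).trans ?_
      have ms : s / q ∈ Icc (0 : ℝ) 1 := ⟨by positivity, (div_le_one hq).2 (hst.trans ht)⟩
      have mt : t / q ∈ Icc (0 : ℝ) 1 :=
        ⟨div_nonneg (hs.trans hst) hq.le, (div_le_one hq).2 ht⟩
      have hle : s / q ≤ t / q := by gcongr
      rw [projIcc_of_mem zero_le_one ms, projIcc_of_mem zero_le_one mt, dist_comm,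
        Subtype.dist_eq, Real.dist_eq, abs_of_nonneg (by simpa using hle)]
      apply le_of_eq
      field_simp
    · rw [Measure.restrict_apply' measurableSet_Icc] at h0
      have : volume ((fun t => q⁻¹ * t) ⁻¹'
          ({t : ℝ | g (projIcc 0 1 zero_le_one t) ∈ E} ∩ Icc 0 1)) = 0 := by
        rw [Real.volume_preimage_mul_left (inv_ne_zero hq.ne'), h0, mul_zero]
      refine measure_mono_null ?_ this
      rintro t ⟨ht, htE⟩
      have e : q⁻¹ * t = t / q := by rw [div_eq_inv_mul]
      refine ⟨?_, ?_⟩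
      · simpa [e] using htE
      · change q⁻¹ * t ∈ Icc (0 : ℝ) 1
        rw [e]
        exact ⟨div_nonneg ht.1 hq.le, (div_le_one hq).2 ht.2⟩
    · simp
    · simp [hq.ne']

/-- The set is the image, under evaluation at the endpoint, of a Borel set of maps; the time spent
in `E` depends measurably on the map because it is the measure of a section of a Borel set. -/
theorem analyticSet_avoidingPath [PolishSpace Z] [MeasurableSpace Z] [BorelSpace Z]
    (hE : MeasurableSet E) (hA : IsOpen A) {q : ℝ} (hq : 0 < q) :
    AnalyticSet {z | ∃ a ∈ A, AvoidingPath E a z q} := by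
  have : PolishSpace C(unitInterval, Z) := polishSpace_continuousMap
  let _ : MeasurableSpace C(unitInterval, Z) := borel _
  have : BorelSpace C(unitInterval, Z) := ⟨rfl⟩
  have hP : MeasurableSet {g : C(unitInterval, Z) | g 0 ∈ A ∧
      (∀ s t, dist (g s) (g t) ≤ q * dist s t) ∧
      volume.restrict (Icc 0 1) {t : ℝ | g (projIcc 0 1 zero_le_one t) ∈ E} = 0} := by
    refine MeasurableSet.inter ?_ (MeasurableSet.inter ?_ ?_)
    · exact (hA.preimage (continuous_eval_const 0)).measurableSet
    · have : IsClosed {g : C(unitInterval, Z) | ∀ s t, dist (g s) (g t) ≤ q * dist s t} := by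
        simp only [ofPred_forall]
        refine isClosed_iInter fun s => isClosed_iInter fun t => isClosed_le ?_ continuous_const
        exact (continuous_eval_const s).dist (continuous_eval_const t)
      exact this.measurableSet
    · have hc : Continuous fun p : C(unitInterval, Z) × ℝ => p.1 (projIcc 0 1 zero_le_one p.2) :=
        continuous_eval.comp (continuous_fst.prodMk ((continuous_projIcc (h := zero_le_one)).comp continuous_snd))
      have hm := measurable_measure_prodMk_left (ν := volume.restrict (Icc (0 : ℝ) 1))
        (hc.measurable hE)
      exact hm (measurableSet_singleton 0)
  have hcont : Continuous fun g : C(unitInterval, Z) => g 1 := continuous_eval_const 1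
  convert hP.analyticSet.image_of_continuous hcont using 1
  ext z
  simp only [mem_ofPred_eq, mem_image, avoidingPath_iff_exists_continuousMap hq]
  constructor
  · rintro ⟨a, ha, g, rfl, h1, h2, h3⟩
    exact ⟨g, ⟨ha, h2, h3⟩, h1⟩
  · rintro ⟨g, ⟨ha, h2, h3⟩, h1⟩
    exact ⟨_, ha, g, rfl, h1, h2, h3⟩

theorem aemeasurable_pathDist [PolishSpace Z] [MeasurableSpace Z] [BorelSpace Z]
    {μ : Measure Z} [SFinite μ] (hE : MeasurableSet E) (hA : IsOpen A) (hM : 0 ≤ M) :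
    AEMeasurable (pathDist E A M) μ := by
  refine NullMeasurable.aemeasurable ?_
  suffices h : @Measurable Z ℝ
    (inferInstanceAs (MeasurableSpace (NullMeasurableSpace Z μ))) _ (pathDist E A M) from
    fun s hs => h hs
  refine measurable_of_Iio (δ := NullMeasurableSpace Z μ) (α := ℝ) fun t => ?_
  change NullMeasurableSet (pathDist E A M ⁻¹' Iio t) μ
  rcases lt_or_ge M t with hMt | hMt
  · convert nullMeasurableSet_univ (μ := μ)
    exact eq_univ_of_forall fun z => (pathDist_le hM z).trans_lt hMt
  rcases le_or_gt t 0 with ht | ht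
  · convert nullMeasurableSet_empty (μ := μ)
    exact eq_empty_of_forall_notMem fun z hz => not_lt.2 (ht.trans (pathDist_nonneg hM z)) hz
  -- Rational lengths suffice because paths of positive length can be slowed down; paths of length
  -- zero contribute only `A`.
  have : pathDist E A M ⁻¹' Iio t =
      A ∪ ⋃ q : {q : ℚ // (0 : ℝ) < q ∧ (q : ℝ) < t}, {z | ∃ a ∈ A, AvoidingPath E a z (q : ℚ)} := by
    ext z
    simp only [mem_preimage, mem_Iio, mem_union, mem_iUnion]
    constructor
    · intro h
      obtain ⟨L, hLt, a, ha, hp⟩ := exists_path_of_pathDist_lt h hMt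
      rcases hp.nonneg.eq_or_lt with h0 | h0
      · left
        have : dist a z ≤ 0 := h0 ▸ hp.dist_le
        rwa [← dist_le_zero.1 this]
      · right
        obtain ⟨q, hq1, hq2⟩ := exists_rat_btwn hLt
        exact ⟨⟨q, h0.trans hq1, hq2⟩, a, ha, hp.mono h0 hq1.le⟩
    · rintro (h | ⟨⟨q, hq0, hqt⟩, a, ha, hp⟩)
      · rwa [pathDist_eq_zero hM h]
      · exact (pathDist_le_of_path hM ha hp).trans_lt hqt
  rw [this]
  refine hA.measurableSet.nullMeasurableSet.union (NullMeasurableSet.iUnion fun q => ?_)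
  exact nullMeasurableSet_of_analyticSet (analyticSet_avoidingPath hE hA q.2.1)

/-- A curve avoiding `E` can be appended to any competitor, so `pathDist` changes along it by at
most its length. -/
theorem isWeakUpperGradient_pathDist [MeasurableSpace Z] [BorelSpace Z] {μ : Measure Z}
    (hE : MeasurableSet E) (h0 : μ E = 0) (hM : 0 ≤ M) :
    IsWeakUpperGradient μ (pathDist E A M) fun _ => (1 : ℝ≥0) :=
  isWeakUpperGradient_const hE h0 fun γ hr ha => by
    rw [NNReal.coe_one, one_mul]
    exact abs_pathDist_sub_le hM (Curve.avoidingPath hr ha)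

end PathDist

/-! ### Filling the gaps of a path -/

section GapFilling

variable {X : Type*} [MetricSpace X]

/-- For points `x, y` at distance less than `R`, the path `σ x y` joins `a x y` to `b x y`, and the
two gaps that it leaves to `x` and `y` are much shorter than `dist x y`. -/
structure IsGapFilling (E : Set X) (K R : ℝ) (a b : X → X → X) (σ : X → X → ℝ → X) : Prop where
  left_le : ∀ x y, dist x y < R → dist x (a x y) ≤ dist x y / 8
  right_le : ∀ x y, dist x y < R → dist (b x y) y ≤ dist x y / 8
  -- Together with the times `2 * K * dist x (a x y)` and `2 * K * dist (b x y) y` reserved for the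
  -- gaps, this duration adds up to `2 * K * dist x y`.
  isAvoiding : ∀ x y, dist x y < R →
    IsAvoiding E (σ x y) (2 * K * (dist x y - dist x (a x y) - dist (b x y) y))
  source : ∀ x y, dist x y < R → σ x y 0 = a x y
  target : ∀ x y, dist x y < R →
    σ x y (2 * K * (dist x y - dist x (a x y) - dist (b x y) y)) = b x y

theorem exists_isGapFilling {E : Set X} {K R : ℝ} (hK : 0 < K)
    (h : ∀ x y : X, x ≠ y → dist x y < R → ∀ ε > 0, ∃ a b, ∃ L ≤ K * dist x y,
      dist x a < ε ∧ dist b y < ε ∧ AvoidingPath E a b L) :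
    ∃ a b σ, IsGapFilling E K R a b σ := by
  have key : ∀ x y : X, ∃ a b, ∃ σ : ℝ → X, dist x y < R →
      dist x a ≤ dist x y / 8 ∧ dist b y ≤ dist x y / 8 ∧
      IsAvoiding E σ (2 * K * (dist x y - dist x a - dist b y)) ∧ σ 0 = a ∧
      σ (2 * K * (dist x y - dist x a - dist b y)) = b := by
    intro x y
    rcases eq_or_ne x y with rfl | hxy
    · obtain ⟨σ, h1, h2, h3⟩ := AvoidingPath.refl E x
      exact ⟨x, x, σ, fun _ => by simpa using ⟨h1, h2⟩⟩
    by_cases hR : dist x y < R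
    · have hd := dist_pos.2 hxy
      obtain ⟨a, b, L, hL, ha, hb, hp⟩ := h x y hxy hR (dist x y / 8) (by positivity)
      have hab : a ≠ b := by
        rintro rfl
        linarith [dist_triangle x a y]
      have hL0 := hp.pos_of_ne hab
      -- The gaps use at most a quarter of the distance, so the available duration is at least
      -- `(3/2) K d(x,y)`, more than the length of the given path.
      obtain ⟨σ, h1, h2, h3⟩ := hp.mono hL0
        (M := 2 * K * (dist x y - dist x a - dist b y)) (by nlinarith)
      exact ⟨a, b, σ, fun _ => ⟨ha.le, hb.le, h1, h2, h3⟩⟩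
    · exact ⟨x, x, fun _ => x, fun h => absurd h hR⟩
  choose a b σ hall using key
  exact ⟨a, b, σ, fun x y hR => (hall x y hR).1, fun x y hR => (hall x y hR).2.1,
    fun x y hR => (hall x y hR).2.2.1, fun x y hR => (hall x y hR).2.2.2.1,
    fun x y hR => (hall x y hR).2.2.2.2⟩

/-- The discontinuous map obtained after filling the gaps `n` times. -/
def gapIter (K : ℝ) (a b : X → X → X) (σ : X → X → ℝ → X) : ℕ → X → X → ℝ → X
  | 0, x, y, t => if t ≤ 0 then x else y
  | n + 1, x, y, t =>
    if t ≤ 2 * K * dist x (a x y) then gapIter K a b σ n x (a x y) t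
    else if t ≤ 2 * K * (dist x y - dist (b x y) y) then σ x y (t - 2 * K * dist x (a x y))
    else gapIter K a b σ n (b x y) y (t - 2 * K * (dist x y - dist (b x y) y))

namespace IsGapFilling

variable {E : Set X} {K R : ℝ} {a b : X → X → X} {σ : X → X → ℝ → X}

theorem dist_left_lt (h : IsGapFilling E K R a b σ) {x y : X} (hR : dist x y < R) :
    dist x (a x y) < R := by
  linarith [h.left_le x y hR, dist_nonneg (x := x) (y := y)]

theorem dist_right_lt (h : IsGapFilling E K R a b σ) {x y : X} (hR : dist x y < R) :
    dist (b x y) y < R := by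
  linarith [h.right_le x y hR, dist_nonneg (x := x) (y := y)]

theorem gapIter_zero (hK : 0 < K) (n : ℕ) (x y : X) : gapIter K a b σ n x y 0 = x := by
  induction n generalizing x y with
  | zero => simp [gapIter]
  | succ n ih =>
    rw [gapIter, if_pos (by positivity), ih]

theorem gapIter_end (h : IsGapFilling E K R a b σ) (hK : 0 < K) (n : ℕ) {x y : X}
    (hR : dist x y < R) : gapIter K a b σ n x y (2 * K * dist x y) = y := by
  induction n generalizing x y with
  | zero =>
    rw [gapIter]
    split_ifs with h0
    · refine dist_le_zero.1 ?_
      by_contra hn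
      push Not at hn
      nlinarith
    · rfl
  | succ n ih =>
    have h1 := h.left_le x y hR
    have h2 := h.right_le x y hR
    rw [gapIter]
    split_ifs with h3 h4
    · have hxy : x = y := by
        refine dist_le_zero.1 ?_
        by_contra hn
        push Not at hn
        nlinarith
      subst hxy
      rw [dist_self, mul_zero]
      exact gapIter_zero hK n _ _
    · have h5 : dist (b x y) y = 0 := by
        refine le_antisymm ?_ dist_nonneg
        by_contra hn
        push Not at hn
        nlinarith
      have h6 := h.target x y hR
      rw [h5] at h6
      exact (congrArg (σ x y) (by ring)).trans (h6.trans (dist_eq_zero.1 h5))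
    · have := ih (h.dist_right_lt hR)
      convert this using 2
      ring

/-- The approximation is `1`-Lipschitz except for its jumps. The middle piece has none, and the two
gaps have at most an eighth of the size each, so the total jump shrinks by a factor `1/4` per stage.
-/
theorem dist_gapIter_le (h : IsGapFilling E K R a b σ) (hK : 0 < K) (n : ℕ) {x y : X}
    (hR : dist x y < R) {s t : ℝ} (hs : 0 ≤ s) (hst : s ≤ t) (ht : t ≤ 2 * K * dist x y) :
    dist (gapIter K a b σ n x y s) (gapIter K a b σ n x y t) ≤
      (t - s) + (1 / 4) ^ n * dist x y := by
  induction n generalizing x y s t with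
  | zero =>
    have := dist_nonneg (x := x) (y := y)
    simp only [gapIter, pow_zero, one_mul]
    split_ifs
    · rw [dist_self]; linarith
    · linarith
    · rw [dist_comm]; linarith
    · rw [dist_self]; linarith
  | succ n ih =>
    have h1 := h.left_le x y hR
    have h2 := h.right_le x y hR
    have hd := dist_nonneg (x := x) (y := y)
    set A := 2 * K * dist x (a x y) with hA
    set B := 2 * K * (dist x y - dist (b x y) y) with hB
    have hA0 : 0 ≤ A := by positivity
    have hAB : A ≤ B := by rw [hA, hB]; gcongr; linarith
    have hBD : B ≤ 2 * K * dist x y := by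
      rw [hB]; gcongr; linarith [dist_nonneg (x := b x y) (y := y)]
    have hmid := (h.isAvoiding x y hR).dist_le
    have hlen : 2 * K * (dist x y - dist x (a x y) - dist (b x y) y) = B - A := by
      rw [hA, hB]; ring
    have hsrc := h.source x y hR
    have htgt := h.target x y hR
    rw [hlen] at hmid htgt
    have hp : (0 : ℝ) < (1 / 4) ^ n := by positivity
    have e1 : (1 / 4 : ℝ) ^ n * dist x (a x y) ≤ (1 / 4) ^ n * (dist x y / 8) := by gcongr
    have e2 : (1 / 4 : ℝ) ^ n * dist (b x y) y ≤ (1 / 4) ^ n * (dist x y / 8) := by gcongr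
    have e3 : (1 / 4 : ℝ) ^ (n + 1) * dist x y = 2 * ((1 / 4) ^ n * (dist x y / 8)) := by
      rw [pow_succ]; ring
    have e0 : 0 ≤ (1 / 4 : ℝ) ^ n * (dist x y / 8) := by positivity
    have hl : ∀ s, 0 ≤ s → s ≤ A → dist (gapIter K a b σ n x (a x y) s) (a x y) ≤
        (A - s) + (1 / 4) ^ n * (dist x y / 8) := by
      intro s hs hsA
      have := ih (h.dist_left_lt hR) hs hsA le_rfl
      rw [h.gapIter_end hK n (h.dist_left_lt hR)] at this
      linarith
    have hr : ∀ t, B ≤ t → t ≤ 2 * K * dist x y →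
        dist (b x y) (gapIter K a b σ n (b x y) y (t - B)) ≤
          (t - B) + (1 / 4) ^ n * (dist x y / 8) := by
      intro t hBt ht
      have := ih (h.dist_right_lt hR) (s := 0) (t := t - B) le_rfl (by linarith) (by
        have : 2 * K * dist (b x y) y = 2 * K * dist x y - B := by rw [hB]; ring
        linarith)
      rw [gapIter_zero hK] at this
      linarith
    rw [gapIter, gapIter, ← hA, ← hB, e3]
    split_ifs with s1 t1 t2 s2 t1 t2 t1 t2
    · have := ih (h.dist_left_lt hR) hs hst t1
      linarith
    · have g1 := hl s hs s1
      have g2 := hmid 0 (t - A) le_rfl (by linarith) (by linarith)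
      rw [hsrc] at g2
      linarith [dist_triangle (gapIter K a b σ n x (a x y) s) (a x y) (σ x y (t - A))]
    · have g1 := hl s hs s1
      have g2 := hmid 0 (B - A) le_rfl (by linarith) le_rfl
      rw [hsrc, htgt] at g2
      have g3 := hr t (by linarith) ht
      linarith [dist_triangle4 (gapIter K a b σ n x (a x y) s) (a x y) (b x y)
        (gapIter K a b σ n (b x y) y (t - B))]
    · linarith
    · have := hmid (s - A) (t - A) (by linarith) (by linarith) (by linarith)
      linarith
    · have g2 := hmid (s - A) (B - A) (by linarith) (by linarith) le_rfl
      rw [htgt] at g2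
      have g3 := hr t (by linarith) ht
      linarith [dist_triangle (σ x y (s - A)) (b x y) (gapIter K a b σ n (b x y) y (t - B))]
    · linarith
    · linarith
    · have := ih (h.dist_right_lt hR) (s := s - B) (t := t - B) (by linarith) (by linarith) (by
        have : 2 * K * dist (b x y) y = 2 * K * dist x y - B := by rw [hB]; ring
        linarith)
      linarith

/-- Consecutive stages differ only inside the gaps, whose sizes decay geometrically; this makes the
stages a Cauchy sequence. -/
theorem dist_gapIter_succ_le (h : IsGapFilling E K R a b σ) (hK : 0 < K) (n : ℕ) {x y : X}
    (hR : dist x y < R) {t : ℝ} (hs : 0 ≤ t) (ht : t ≤ 2 * K * dist x y) :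
    dist (gapIter K a b σ n x y t) (gapIter K a b σ (n + 1) x y t) ≤
      (2 * K + 2) * dist x y * (1 / 4) ^ n := by
  induction n generalizing x y t with
  | zero =>
    have h1 := h.dist_gapIter_le hK 1 hR le_rfl hs ht
    have h2 := h.dist_gapIter_le hK 0 hR le_rfl hs ht
    rw [gapIter_zero hK] at h1 h2
    have hd := dist_nonneg (x := x) (y := y)
    rw [zero_add]
    have h3 : dist (gapIter K a b σ 0 x y t) x ≤ dist x y := by
      rw [gapIter]
      split_ifs
      · simp
      · rw [dist_comm]
    have h4 := dist_triangle (gapIter K a b σ 0 x y t) x (gapIter K a b σ 1 x y t)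
    simp only [pow_one, pow_zero] at *
    nlinarith
  | succ n ih =>
    have h1 := h.left_le x y hR
    have h2 := h.right_le x y hR
    have hd := dist_nonneg (x := x) (y := y)
    have hp : (0 : ℝ) < (1 / 4) ^ n := by positivity
    have e1 : (2 * K + 2) * dist x (a x y) * (1 / 4) ^ n ≤
      (2 * K + 2) * (dist x y / 8) * (1 / 4) ^ n := by gcongr
    have e2 : (2 * K + 2) * dist (b x y) y * (1 / 4) ^ n ≤
      (2 * K + 2) * (dist x y / 8) * (1 / 4) ^ n := by gcongr
    have e0 : 0 ≤ (2 * K + 2) * (dist x y / 8) * (1 / 4) ^ n := by positivity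
    have e3 : (2 * K + 2) * dist x y * (1 / 4) ^ (n + 1) =
        2 * ((2 * K + 2) * (dist x y / 8) * (1 / 4) ^ n) := by
      rw [pow_succ]; ring
    rw [gapIter, gapIter, e3]
    split_ifs with t1 t2
    · have := ih (h.dist_left_lt hR) hs t1
      linarith
    · rw [dist_self]; linarith
    · have := ih (h.dist_right_lt hR) (t := t - 2 * K * (dist x y - dist (b x y) y))
        (by linarith) (by linarith)
      linarith

theorem exists_limit [CompleteSpace X] (h : IsGapFilling E K R a b σ) (hK : 0 < K) :
    ∃ Ψ : X → X → ℝ → X, ∀ x y, dist x y < R → ∀ t, 0 ≤ t → t ≤ 2 * K * dist x y →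
      Tendsto (fun n => gapIter K a b σ n x y t) atTop (𝓝 (Ψ x y t)) := by
  have key : ∀ x y : X, ∀ t : ℝ, ∃ z, dist x y < R → 0 ≤ t → t ≤ 2 * K * dist x y →
      Tendsto (fun n => gapIter K a b σ n x y t) atTop (𝓝 z) := by
    intro x y t
    by_cases hc : dist x y < R ∧ 0 ≤ t ∧ t ≤ 2 * K * dist x y
    · obtain ⟨h1, h2, h3⟩ := hc
      have := cauchySeq_of_le_geometric (1 / 4 : ℝ) ((2 * K + 2) * dist x y) (by norm_num)
        fun n => h.dist_gapIter_succ_le hK n h1 h2 h3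
      obtain ⟨z, hz⟩ := cauchySeq_tendsto_of_complete this
      exact ⟨z, fun _ _ _ => hz⟩
    · exact ⟨x, fun h1 h2 h3 => absurd ⟨h1, h2, h3⟩ hc⟩
  choose Ψ hΨ using key
  exact ⟨Ψ, fun x y hR t h1 h2 => hΨ x y t hR h1 h2⟩

/-- The limit is self-similar: it equals `σ` in the middle and the limits for the two gaps on either
side. The vanishing jumps make it `1`-Lipschitz. -/
theorem avoidingPath [CompleteSpace X] (h : IsGapFilling E K R a b σ) (hK : 0 < K) {x y : X}
    (hR : dist x y < R) : AvoidingPath E x y (2 * K * dist x y) := by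
  obtain ⟨Ψ, hΨ⟩ := h.exists_limit hK
  have hleft : ∀ x y, dist x y < R → ∀ t, 0 ≤ t → t ≤ 2 * K * dist x (a x y) →
      Ψ x y t = Ψ x (a x y) t := by
    intro x y hR t h0 h1
    have h2 := h.left_le x y hR
    have h3 := hΨ x (a x y) (h.dist_left_lt hR) t h0 h1
    have h4 := (hΨ x y hR t h0 (h1.trans (by
      gcongr; linarith [dist_nonneg (x := x) (y := y)]))).comp (tendsto_add_atTop_nat 1)
    refine tendsto_nhds_unique (h4.congr fun n => ?_) h3
    simp only [Function.comp_apply, gapIter, if_pos h1]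
  have hmid : ∀ x y, dist x y < R → ∀ t, 2 * K * dist x (a x y) < t →
      t ≤ 2 * K * (dist x y - dist (b x y) y) → Ψ x y t = σ x y (t - 2 * K * dist x (a x y)) := by
    intro x y hR t h0 h1
    have h4 := (hΨ x y hR t ((by positivity : 0 ≤ 2 * K * dist x (a x y)).trans h0.le)
      (h1.trans (by
        gcongr; linarith [dist_nonneg (x := b x y) (y := y)]))).comp (tendsto_add_atTop_nat 1)
    refine tendsto_nhds_unique (h4.congr fun n => ?_) tendsto_const_nhds
    simp only [Function.comp_apply, gapIter, if_neg (not_le.2 h0), if_pos h1]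
  have hright : ∀ x y, dist x y < R → ∀ t, 2 * K * (dist x y - dist (b x y) y) < t →
      t ≤ 2 * K * dist x y →
      Ψ x y t = Ψ (b x y) y (t - 2 * K * (dist x y - dist (b x y) y)) := by
    intro x y hR t h0 h1
    have h5 := h.left_le x y hR
    have h6 := h.right_le x y hR
    have h7 : 2 * K * dist x (a x y) ≤ 2 * K * (dist x y - dist (b x y) y) := by
      gcongr; linarith [dist_nonneg (x := x) (y := y)]
    have h3 := hΨ (b x y) y (h.dist_right_lt hR) (t - 2 * K * (dist x y - dist (b x y) y))
      (by linarith) (by linarith)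
    have h4 := (hΨ x y hR t (((by positivity : 0 ≤ 2 * K * dist x (a x y)).trans h7).trans h0.le)
      h1).comp (tendsto_add_atTop_nat 1)
    refine tendsto_nhds_unique (h4.congr fun n => ?_) h3
    simp only [Function.comp_apply, gapIter, if_neg (not_le.2 h0),
      if_neg (not_le.2 (h7.trans_lt h0))]
  -- The middle piece spends no time in `E`, and the gaps occupy at most a quarter of the duration,
  -- so each use of self-similarity improves the bound by `1/4`. Letting `n` grow shows that the
  -- time is zero.
  have hmeas : ∀ n : ℕ, ∀ x y, dist x y < R →
      volume (Icc 0 (2 * K * dist x y) ∩ Ψ x y ⁻¹' E) ≤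
        ENNReal.ofReal (2 * K * dist x y * (1 / 4) ^ n) := by
    intro n
    induction n with
    | zero =>
      intro x y _
      refine (measure_mono inter_subset_left).trans ?_
      rw [Real.volume_Icc, sub_zero, pow_zero, mul_one]
    | succ n ih =>
      intro x y hR
      have h1 := h.left_le x y hR
      have h2 := h.right_le x y hR
      have hn1 := (measurePreserving_sub_right volume (2 * K * dist x (a x y))
        ).quasiMeasurePreserving.preimage_null (h.isAvoiding x y hR).null
      set T := Icc 0 (2 * K * dist (b x y) y) ∩ Ψ (b x y) y ⁻¹' E
      have hn2 : volume ((fun t => t - 2 * K * (dist x y - dist (b x y) y)) ⁻¹' T) = volume T := by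
        simp only [sub_eq_add_neg]
        exact measure_preimage_add_right _ _ _
      have hsub : Icc 0 (2 * K * dist x y) ∩ Ψ x y ⁻¹' E ⊆
          (Icc 0 (2 * K * dist x (a x y)) ∩ Ψ x (a x y) ⁻¹' E) ∪
          (((fun t => t - 2 * K * dist x (a x y)) ⁻¹'
            (Icc 0 (2 * K * (dist x y - dist x (a x y) - dist (b x y) y)) ∩ σ x y ⁻¹' E)) ∪
          ((fun t => t - 2 * K * (dist x y - dist (b x y) y)) ⁻¹' T)) := by
        rintro t ⟨⟨ht0, ht1⟩, htE⟩
        rw [mem_preimage] at htE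
        rcases le_or_gt t (2 * K * dist x (a x y)) with hA | hA
        · rw [hleft x y hR t ht0 hA] at htE
          exact Or.inl ⟨⟨ht0, hA⟩, htE⟩
        rcases le_or_gt t (2 * K * (dist x y - dist (b x y) y)) with hB | hB
        · rw [hmid x y hR t hA hB] at htE
          exact Or.inr (Or.inl ⟨⟨by linarith, by linarith⟩, htE⟩)
        · rw [hright x y hR t hB ht1] at htE
          exact Or.inr (Or.inr ⟨⟨by linarith, by linarith⟩, htE⟩)
      refine (measure_mono hsub).trans ((measure_union_le _ _).trans ?_)
      refine (add_le_add (ih x _ (h.dist_left_lt hR)) (measure_union_le _ _)).trans ?_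
      rw [hn1, hn2, zero_add]
      refine (add_le_add le_rfl (ih _ y (h.dist_right_lt hR))).trans ?_
      rw [← ENNReal.ofReal_add (by positivity) (by positivity)]
      refine ENNReal.ofReal_le_ofReal ?_
      have e : 2 * K * dist x y * (1 / 4 : ℝ) ^ (n + 1) =
          2 * K * (dist x y / 8) * (1 / 4) ^ n + 2 * K * (dist x y / 8) * (1 / 4) ^ n := by
        rw [pow_succ]; ring
      rw [e]
      gcongr
  have hD : 0 ≤ 2 * K * dist x y := by positivity
  refine ⟨Ψ x y, ⟨hD, fun s t hs hst ht => ?_, ?_⟩, ?_, ?_⟩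
  · have h1 := (hΨ x y hR s hs (hst.trans ht)).dist (hΨ x y hR t (hs.trans hst) ht)
    have h2 : Tendsto (fun n : ℕ => (t - s) + (1 / 4 : ℝ) ^ n * dist x y) atTop
        (𝓝 ((t - s) + 0 * dist x y)) :=
      ((tendsto_pow_atTop_nhds_zero_of_lt_one (by norm_num) (by norm_num)).mul_const _).const_add _
    rw [zero_mul, add_zero] at h2
    exact le_of_tendsto_of_tendsto' h1 h2 fun n => h.dist_gapIter_le hK n hR hs hst ht
  · have h2 : Tendsto (fun n : ℕ => ENNReal.ofReal (2 * K * dist x y * (1 / 4 : ℝ) ^ n)) atTop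
        (𝓝 (ENNReal.ofReal (2 * K * dist x y * 0))) :=
      ENNReal.tendsto_ofReal ((tendsto_pow_atTop_nhds_zero_of_lt_one (by norm_num)
        (by norm_num)).const_mul _)
    rw [mul_zero, ENNReal.ofReal_zero] at h2
    exact le_antisymm (ge_of_tendsto' h2 fun n => hmeas n x y hR) zero_le
  · refine tendsto_nhds_unique (hΨ x y hR 0 le_rfl hD) ?_
    simp only [gapIter_zero hK]
    exact tendsto_const_nhds
  · refine tendsto_nhds_unique (hΨ x y hR _ hD le_rfl) ?_
    simp only [h.gapIter_end hK _ hR]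
    exact tendsto_const_nhds

end IsGapFilling

/-- In a complete space, nearby points can be joined by a path avoiding `E` as soon as arbitrarily
good approximations to them can. -/
theorem avoidingPath_of_approx [CompleteSpace X] {E : Set X} {K R : ℝ} (hK : 0 < K)
    (h : ∀ x y : X, x ≠ y → dist x y < R → ∀ ε > 0, ∃ a b, ∃ L ≤ K * dist x y,
      dist x a < ε ∧ dist b y < ε ∧ AvoidingPath E a b L) {x y : X} (hR : dist x y < R) :
    AvoidingPath E x y (2 * K * dist x y) := by
  obtain ⟨a, b, σ, hf⟩ := exists_isGapFilling hK h
  exact hf.avoidingPath hK hR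

end GapFilling

/-! ### Lipschitz control of functions with unit upper gradient -/

section Control

variable {Z : Type*} [MetricSpace Z] [MeasurableSpace Z]

/-- `u` is `K`-Lipschitz off a null set. -/
def AELipschitz (μ : Measure Z) (K : ℝ) (u : Z → ℝ) : Prop :=
  ∃ N, μ N = 0 ∧ ∀ x ∉ N, ∀ y ∉ N, |u x - u y| ≤ K * dist x y

/-- The functions with values in `[0, M]` that have the constant `1` as a weak upper gradient. -/
def unitGradientFunctions (μ : Measure Z) (M : ℝ) : Set (Z → ℝ) :=
  {u | AEMeasurable u μ ∧ (∀ z, 0 ≤ u z ∧ u z ≤ M) ∧ IsWeakUpperGradient μ u fun _ => (1 : ℝ≥0)}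

/-- Functions with values in `[0, M]` and weak upper gradient `1` are `K`-Lipschitz almost
everywhere. -/
def LipschitzControl (μ : Measure Z) (K M : ℝ) : Prop :=
  ∀ u ∈ unitGradientFunctions μ M, AELipschitz μ K u

variable {μ : Measure Z}

theorem AELipschitz.mono {K K' : ℝ} {u : Z → ℝ} (h : AELipschitz μ K u) (hK : K ≤ K') :
    AELipschitz μ K' u := by
  obtain ⟨N, h0, h⟩ := h
  exact ⟨N, h0, fun x hx y hy => (h x hx y hy).trans (by gcongr)⟩

theorem aeLipschitz_of_ae_eq {u f : Z → ℝ} {L : ℝ≥0} (h : u =ᵐ[μ] f) (hf : LipschitzWith L f) :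
    AELipschitz μ L u := by
  refine ⟨{z | ¬ u z = f z}, ae_iff.1 h, fun x hx y hy => ?_⟩
  simp only [mem_ofPred_eq, not_not] at hx hy
  rw [hx, hy, ← Real.dist_eq]
  exact hf.dist_le_mul x y

theorem aeLipschitz_of_lipEnergy_lt {u : Z → ℝ} {U : Lp ℝ ∞ μ} (hU : U =ᵐ[μ] u) {K : ℝ≥0}
    (h : lipEnergy μ U < K) : AELipschitz μ K u := by
  obtain ⟨f, h⟩ := iInf_lt_iff.1 h
  obtain ⟨hf, h⟩ := iInf_lt_iff.1 h
  obtain ⟨L, h⟩ := iInf_lt_iff.1 h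
  obtain ⟨hL, h2⟩ := iInf_lt_iff.1 h
  exact (aeLipschitz_of_ae_eq (hU.symm.trans hf.2) hL).mono
    (NNReal.coe_le_coe.2 (ENNReal.coe_lt_coe.1 h2).le)

theorem exists_Lp_of_mem_unitGradientFunctions {u : Z → ℝ} {M : ℝ}
    (hu : u ∈ unitGradientFunctions μ M) : ∃ U : Lp ℝ ∞ μ, U =ᵐ[μ] u ∧ U ∈ sobolev μ ∧
      sobolevEnergy μ U ≤ 1 ∧ eLpNorm U ∞ μ ≤ ENNReal.ofReal M := by
  obtain ⟨hm, hb, hg⟩ := hu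
  have habs : ∀ z, |u z| ≤ M := fun z => by rw [abs_of_nonneg (hb z).1]; exact (hb z).2
  have hN : u ∈ NewtonSobolev μ := mem_newtonSobolev_of_const hm.aestronglyMeasurable habs hg
  have hU := hN.1.coeFn_toLp
  refine ⟨hN.1.toLp u, hU, ⟨u, hN, hU⟩, ?_, ?_⟩
  · exact (iInf₂_le u ⟨hN, hU⟩).trans (newtonEnergy_le_of_const hg)
  · rw [eLpNorm_congr_ae hU, eLpNorm_exponent_top]
    exact eLpNormEssSup_le_of_ae_bound (Eventually.of_forall habs)

/-- Energies ignore the sup norm, so every truncation level `M` is allowed. The factor `2` makes the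
bound strict, so that a representative with such a Lipschitz constant can be extracted from the
infimum. -/
theorem lipschitzControl_of_condition3 {K : ℝ≥0} (hK : 1 ≤ K) (h : Condition3 μ K) (M : ℝ) :
    LipschitzControl μ (2 * K : ℝ≥0) M := by
  intro u hu
  obtain ⟨U, hU, hs, he, -⟩ := exists_Lp_of_mem_unitGradientFunctions hu
  refine aeLipschitz_of_lipEnergy_lt hU (((h.2 U hs).1.trans (mul_le_mul_right he _)).trans_lt ?_)
  rw [mul_one, ENNReal.coe_lt_coe]
  exact lt_mul_of_one_lt_left (zero_lt_one.trans_le hK) one_lt_two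

/-- Here the sup norm enters, so the truncation is fixed at `1`: the Sobolev norm is then at most
`2`, and `3` leaves room for strictness. -/
theorem lipschitzControl_of_normsComparable {c : ℝ≥0} (hc : 0 < c) (h : NormsComparable μ c) :
    LipschitzControl μ (3 / c : ℝ≥0) 1 := by
  intro u hu
  obtain ⟨U, hU, hs, he, hn⟩ := exists_Lp_of_mem_unitGradientFunctions hu
  refine aeLipschitz_of_lipEnergy_lt hU ?_
  have hc0 : (c : ℝ≥0∞) ≠ 0 := ENNReal.coe_ne_zero.2 hc.ne'
  rw [ENNReal.coe_div hc.ne', ENNReal.lt_div_iff_mul_lt (Or.inl hc0) (Or.inl ENNReal.coe_ne_top),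
    mul_comm]
  calc c * lipEnergy μ U ≤ c * lipNorm μ U := mul_le_mul_right le_add_self _
    _ ≤ sobolevNorm μ U := (h U hs).1
    _ ≤ ENNReal.ofReal 1 + 1 := add_le_add hn he
    _ < (3 : ℝ≥0) := by
      rw [ENNReal.ofReal_one]
      norm_num

theorem aeLipschitz_of_tendsto {K : ℝ} {v : ℕ → Z → ℝ} {u : Z → ℝ}
    (hv : ∀ n, AELipschitz μ K (v n))
    (h : ∀ z, Tendsto (fun n => v n z) atTop (𝓝 (u z))) : AELipschitz μ K u := by
  choose N h0 h1 using hv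
  refine ⟨⋃ n, N n, measure_iUnion_null h0, fun x hx y hy => ?_⟩
  rw [mem_iUnion, not_exists] at hx hy
  exact le_of_tendsto' ((h x).sub (h y)).abs fun n => h1 n x (hx n) y (hy n)

variable [BorelSpace Z]

theorem isWeakUpperGradient_one_iff {u : Z → ℝ} :
    (IsWeakUpperGradient μ u fun _ => (1 : ℝ≥0)) ↔ ∃ E, MeasurableSet E ∧ μ E = 0 ∧
      ∀ γ : Curve Z, γ.Rectifiable → γ.Avoids E →
        |u γ.source - u γ.target| ≤ γ.length.toReal := by
  constructor
  · intro h
    obtain ⟨E, hE, h0, h1⟩ := h.exists_null MeasurableSet.univ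
    refine ⟨E, hE, h0, fun γ hr ha => ?_⟩
    have h2 := h1 γ hr ha fun _ _ => mem_univ _
    have h3 : essSup (fun _ : Z => ((1 : ℝ≥0) : ℝ≥0∞)) (μ.restrict univ) ≤ 1 :=
      essSup_le_of_ae_le _ (Eventually.of_forall fun _ => le_rfl)
    refine (ENNReal.ofReal_le_iff_le_toReal (ne_of_lt hr)).1 (h2.trans ?_)
    calc _ ≤ 1 * γ.length := by gcongr
      _ = γ.length := one_mul _
  · rintro ⟨E, hE, h0, h⟩
    exact isWeakUpperGradient_const hE h0 fun γ hr ha => by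
      rw [NNReal.coe_one, one_mul]
      exact h γ hr ha

theorem unitGradientFunctions_of_tendsto {M : ℝ} {v : ℕ → Z → ℝ} {u : Z → ℝ}
    (hv : ∀ n, v n ∈ unitGradientFunctions μ M)
    (h : ∀ z, Tendsto (fun n => v n z) atTop (𝓝 (u z))) : u ∈ unitGradientFunctions μ M := by
  refine ⟨aemeasurable_of_tendsto_metrizable_ae' (fun n => (hv n).1) (Eventually.of_forall h),
    fun z => ⟨ge_of_tendsto' (h z) fun n => ((hv n).2.1 z).1,
      le_of_tendsto' (h z) fun n => ((hv n).2.1 z).2⟩, ?_⟩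
  choose E hE h0 h1 using fun n => isWeakUpperGradient_one_iff.1 (hv n).2.2
  refine isWeakUpperGradient_one_iff.2 ⟨⋃ n, E n, MeasurableSet.iUnion hE,
    measure_iUnion_null h0, fun γ hr ha => ?_⟩
  exact le_of_tendsto' ((h _).sub (h _)).abs fun n => h1 n γ hr (ha.mono (subset_iUnion E n))

theorem convex_unitGradientFunctions {M : ℝ} {v u : Z → ℝ} (hv : v ∈ unitGradientFunctions μ M)
    (hu : u ∈ unitGradientFunctions μ M) {t : ℝ} (ht0 : 0 ≤ t) (ht1 : t ≤ 1) :
    (fun z => v z + t * (u z - v z)) ∈ unitGradientFunctions μ M := by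
  refine ⟨hv.1.add ((hu.1.sub hv.1).const_mul t), fun z => ⟨?_, ?_⟩, ?_⟩
  · nlinarith [(hv.2.1 z).1, (hu.2.1 z).1]
  · nlinarith [(hv.2.1 z).2, (hu.2.1 z).2]
  · obtain ⟨E, hE, h0, h1⟩ := isWeakUpperGradient_one_iff.1 hv.2.2
    obtain ⟨F, hF, h0', h1'⟩ := isWeakUpperGradient_one_iff.1 hu.2.2
    refine isWeakUpperGradient_one_iff.2 ⟨E ∪ F, hE.union hF, measure_union_null h0 h0',
      fun γ hr ha => ?_⟩
    have a1 := abs_le.1 (h1 γ hr (ha.mono subset_union_left))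
    have a2 := abs_le.1 (h1' γ hr (ha.mono subset_union_right))
    rw [abs_le]
    constructor <;> nlinarith

/-- If every Sobolev function is Lipschitz, then the Lipschitz constants are uniformly
controlled, by the Baire category theorem. -/
theorem exists_lipschitzControl_of_lipSpace_eq (h : lipSpace μ = sobolev μ) :
    ∃ K : ℝ≥0, 0 < K ∧ LipschitzControl μ K 1 := by
  -- Baire's theorem is applied to functions under uniform convergence, not to classes; this set is
  -- closed, hence complete.
  let Y : Set (UniformFun Z ℝ) := {v | UniformFun.toFun v ∈ unitGradientFunctions μ 1}
  let F : ℕ → Set Y := fun n => {v | AELipschitz μ n (UniformFun.toFun v.1)}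
  have hpt : ∀ {v : ℕ → UniformFun Z ℝ} {u : UniformFun Z ℝ}, Tendsto v atTop (𝓝 u) →
      ∀ z, Tendsto (fun n => UniformFun.toFun (v n) z) atTop (𝓝 (UniformFun.toFun u z)) :=
    fun hvu z => (UniformFun.tendsto_iff_tendstoUniformly.1 hvu).tendsto_at z
  have hYc : IsClosed Y := IsSeqClosed.isClosed fun v u hv hvu =>
    unitGradientFunctions_of_tendsto hv (hpt hvu)
  have hFc : ∀ n, IsClosed (F n) := fun n => IsSeqClosed.isClosed fun v u hv hvu =>
    aeLipschitz_of_tendsto hv (hpt ((continuous_subtype_val.tendsto u).comp hvu))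
  have hU : ⋃ n, F n = univ := by
    refine eq_univ_of_forall fun v => ?_
    obtain ⟨U, hU, hs, -, -⟩ := exists_Lp_of_mem_unitGradientFunctions v.2
    rw [← h] at hs
    obtain ⟨f, ⟨⟨L, hL⟩, -⟩, hf⟩ := hs
    obtain ⟨n, hn⟩ := exists_nat_ge (L : ℝ)
    exact mem_iUnion.2 ⟨n, (aeLipschitz_of_ae_eq (hU.symm.trans hf) hL).mono hn⟩
  have hne : Nonempty Y := by
    refine ⟨UniformFun.ofFun fun _ => 0, aemeasurable_const, fun _ => by simp, ?_⟩
    exact isWeakUpperGradient_one_iff.2 ⟨∅, MeasurableSet.empty, measure_empty, fun γ _ _ => by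
      simp⟩
  have : CompleteSpace Y := hYc.completeSpace_coe
  obtain ⟨n, v, hv⟩ := nonempty_interior_of_iUnion_of_closed hFc hU
  obtain ⟨ε, hε, hball⟩ := EMetric.mem_nhds_iff.1 (mem_interior_iff_mem_nhds.1 hv)
  obtain ⟨s, hs0, hsε⟩ := ENNReal.lt_iff_exists_nnreal_btwn.1 hε
  obtain ⟨t, ht0, ht1, hts⟩ : ∃ t : ℝ≥0, 0 < t ∧ t ≤ 1 ∧ t ≤ s :=
    ⟨min s 1, lt_min (ENNReal.coe_pos.1 hs0) zero_lt_one, min_le_right _ _, min_le_left _ _⟩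
  have ht0' : (0 : ℝ) < t := ht0
  obtain ⟨N, hN, hvN⟩ : AELipschitz μ n (UniformFun.toFun v.1) :=
    show v ∈ F n from interior_subset hv
  -- Moving from the interior point `v` by a fraction `t` towards `u` stays inside `F n`; solving
  -- for `u` costs `2 * n / t`. The summand `1` secures positivity.
  refine ⟨2 * n / t + 1, by positivity, fun u hu => ?_⟩
  let w : Z → ℝ := fun z => UniformFun.toFun v.1 z + t * (u z - UniformFun.toFun v.1 z)
  have hw : w ∈ unitGradientFunctions μ 1 := convex_unitGradientFunctions v.2 hu t.2 ht1
  have hwv : (⟨UniformFun.ofFun w, hw⟩ : Y) ∈ Metric.eball v ε := by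
    rw [Metric.mem_eball, Subtype.edist_eq]
    refine lt_of_le_of_lt ?_ ((ENNReal.coe_le_coe.2 hts).trans_lt hsε)
    refine UniformFun.edist_le.2 fun z => ?_
    rw [edist_dist, Real.dist_eq]
    refine ENNReal.ofReal_le_of_le_toReal ?_
    have h1 : UniformFun.toFun (UniformFun.ofFun w) z - UniformFun.toFun v.1 z =
        t * (u z - UniformFun.toFun v.1 z) := by
      simp [w]
    rw [ENNReal.coe_toReal, h1, abs_mul, abs_of_pos ht0']
    refine mul_le_of_le_one_right t.2 (abs_le.2 ⟨?_, ?_⟩)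
    · linarith [(hu.2.1 z).1, (v.2.2.1 z).2]
    · linarith [(hu.2.1 z).2, (v.2.2.1 z).1]
  obtain ⟨N', hN', hwN⟩ : AELipschitz μ n w := hball hwv
  refine ⟨N ∪ N', measure_union_null hN hN', fun x hx y hy => ?_⟩
  simp only [mem_union, not_or] at hx hy
  have a1 := abs_le.1 (hvN x hx.1 y hy.1)
  have a2 := abs_le.1 (hwN x hx.2 y hy.2)
  have hd := dist_nonneg (x := x) (y := y)
  have key : t * |u x - u y| ≤ 2 * n * dist x y := by
    rw [← abs_of_pos ht0', ← abs_mul, abs_le]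
    have ht1' : (t : ℝ) ≤ 1 := ht1
    have hnd : 0 ≤ n * dist x y := by positivity
    simp only [w] at a2
    have b1 := mul_le_mul_of_nonneg_left a1.1 (sub_nonneg.2 ht1')
    have b2 := mul_le_mul_of_nonneg_left a1.2 (sub_nonneg.2 ht1')
    constructor <;> nlinarith
  have : |u x - u y| ≤ 2 * n * dist x y / t := by
    rw [le_div_iff₀ ht0']
    linarith
  push_cast
  calc |u x - u y| ≤ 2 * n * dist x y / t := this
    _ = 2 * n / t * dist x y := by ring
    _ ≤ (2 * n / t + 1) * dist x y := by nlinarith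

end Control

/-! ### From Lipschitz control to thick quasiconvexity -/

section Thickness

variable {Z : Type*} [MetricSpace Z]

/-- A quasiconvexity curve is cut into pieces shorter than `R` and each is replaced by an avoiding
path; only the division points of the curve are kept. -/
theorem exists_avoidingPath_of_quasiconvex {E : Set Z} {C : ℝ≥0} {K R : ℝ} (hR : 0 < R)
    (hK : 0 ≤ K) (hC : Quasiconvex Z C)
    (h : ∀ x y : Z, dist x y < R → ∃ L ≤ K * dist x y, AvoidingPath E x y L) (x y : Z) :
    ∃ L ≤ K * C * dist x y, AvoidingPath E x y L := by
  obtain ⟨γ, hr, rfl, rfl, hl⟩ := hC x y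
  set ℓ := γ.length.toReal with hℓ
  have hℓ0 : 0 ≤ ℓ := ENNReal.toReal_nonneg
  have hℓC : ℓ ≤ C * dist γ.source γ.target := by
    refine ENNReal.toReal_le_of_le_ofReal (by positivity) (hl.trans_eq ?_)
    rw [ENNReal.ofReal_mul C.coe_nonneg, ENNReal.ofReal_coe_nnreal, edist_dist]
  obtain ⟨n, hn⟩ := exists_nat_gt (ℓ / R)
  have hn0 : (0 : ℝ) < n := lt_of_le_of_lt (by positivity) hn
  have hδ : ℓ / n < R := by
    rw [div_lt_iff₀ hR] at hn
    rw [div_lt_iff₀ hn0]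
    linarith
  have key : ∀ k : ℕ, k ≤ n → ∃ L ≤ K * (k * (ℓ / n)),
      AvoidingPath E (γ.arcLength 0) (γ.arcLength (k * (ℓ / n))) L := by
    intro k
    induction k with
    | zero => exact fun _ => ⟨0, by simp, by simpa using AvoidingPath.refl E _⟩
    | succ k ih =>
      intro hk
      obtain ⟨L, hL, hp⟩ := ih (by lia)
      have hk' : ((k : ℝ) + 1) ≤ n := by exact_mod_cast hk
      have hstep : dist (γ.arcLength (k * (ℓ / n))) (γ.arcLength ((k + 1 : ℕ) * (ℓ / n))) ≤
          ℓ / n := by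
        refine (Curve.dist_arcLength_le hr (by positivity) (by gcongr; simp) ?_).trans_eq ?_
        · push_cast
          calc ((k : ℝ) + 1) * (ℓ / n) ≤ n * (ℓ / n) := by gcongr
            _ = ℓ := by field_simp
        · push_cast
          ring
      obtain ⟨L', hL', hp'⟩ := h _ _ (hstep.trans_lt hδ)
      refine ⟨L + L', ?_, hp.trans hp'⟩
      have : K * dist (γ.arcLength (k * (ℓ / n))) (γ.arcLength ((k + 1 : ℕ) * (ℓ / n))) ≤
          K * (ℓ / n) := by gcongr
      push_cast at *
      linarith
  obtain ⟨L, hL, hp⟩ := key n le_rfl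
  have e : n * (ℓ / n) = ℓ := by field_simp
  rw [e] at hL hp
  rw [Curve.arcLength_zero hr, hℓ, Curve.arcLength_length hr] at hp
  refine ⟨L, hL.trans ?_, hp⟩
  rw [mul_assoc]
  gcongr

variable [MeasurableSpace Z] {μ : Measure Z}

theorem exists_mem_ball_notMem [μ.IsOpenPosMeasure] {N : Set Z} (hN : μ N = 0) (x : Z) {r : ℝ}
    (hr : 0 < r) : ∃ z, dist x z < r ∧ z ∉ N := by
  have : (Metric.ball x r \ N).Nonempty := by
    refine nonempty_of_measure_ne_zero (μ := μ) ?_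
    rw [measure_sdiff_null hN]
    exact (Metric.measure_ball_pos μ x hr).ne'
  obtain ⟨z, hz, hzN⟩ := this
  exact ⟨z, by rwa [dist_comm], hzN⟩

variable [BorelSpace Z]

/-- The distance is measured from a ball because the Lipschitz bound may fail at `x`, but it holds
at some points of the ball, where `pathDist` is zero. The condition `hM` keeps the truncation
inactive, so a small value at `y'` comes from an actual path. -/
theorem LipschitzControl.exists_path [PolishSpace Z] [SFinite μ] [μ.IsOpenPosMeasure] {K M : ℝ}
    (h : LipschitzControl μ K M) (hK : 0 < K) {E : Set Z} (hE : MeasurableSet E) (h0 : μ E = 0)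
    {x y : Z} (hxy : x ≠ y) (hM : 2 * K * dist x y ≤ M) {ε : ℝ} (hε : 0 < ε) :
    ∃ a b, ∃ L ≤ 2 * K * dist x y, dist x a < ε ∧ dist b y < ε ∧ AvoidingPath E a b L := by
  have hd := dist_pos.2 hxy
  have hM0 : 0 ≤ M := le_trans (by positivity) hM
  obtain ⟨N, hN, hu⟩ := h (pathDist E (Metric.ball x ε) M)
    ⟨aemeasurable_pathDist hE Metric.isOpen_ball hM0,
      fun z => ⟨pathDist_nonneg hM0 z, pathDist_le hM0 z⟩, isWeakUpperGradient_pathDist hE h0 hM0⟩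
  have hη : 0 < min ε (dist x y / 4) := lt_min hε (by positivity)
  obtain ⟨x', hx', hxN⟩ := exists_mem_ball_notMem hN x hη
  obtain ⟨y', hy', hyN⟩ := exists_mem_ball_notMem hN y hη
  have h1 := hu x' hxN y' hyN
  have hxb : x' ∈ Metric.ball x ε := by
    rw [Metric.mem_ball, dist_comm]
    exact hx'.trans_le (min_le_left _ _)
  rw [pathDist_eq_zero hM0 hxb, zero_sub, abs_neg, abs_of_nonneg (pathDist_nonneg hM0 _)] at h1
  have h2 : dist x' y' < 2 * dist x y := by
    have := dist_triangle4 x' x y y'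
    rw [dist_comm x' x] at this
    linarith [hx'.trans_le (min_le_right _ _), hy'.trans_le (min_le_right _ _)]
  have h3 : pathDist E (Metric.ball x ε) M y' < 2 * K * dist x y :=
    h1.trans_lt (by nlinarith)
  obtain ⟨L, hL, a, ha, hp⟩ := exists_path_of_pathDist_lt h3 hM
  refine ⟨a, y', L, hL.le, ?_, ?_, hp⟩
  · rwa [dist_comm]
  · rw [dist_comm]
    exact hy'.trans_le (min_le_left _ _)

/-- Points of the completion are replaced by points of `Z` at most `5/4` times as far apart, which
turns `2 * K` into at most `3 * K`. -/
theorem LipschitzControl.exists_path_completion [PolishSpace Z] [SFinite μ] [μ.IsOpenPosMeasure]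
    {K M : ℝ} (h : LipschitzControl μ K M) (hK : 0 < K) {E : Set Z} (hE : MeasurableSet E)
    (h0 : μ E = 0) {x y : UniformSpace.Completion Z} (hxy : x ≠ y) (hM : dist x y < M / (3 * K))
    {ε : ℝ} (hε : 0 < ε) :
    ∃ a b, ∃ L ≤ 3 * K * dist x y, dist x a < ε ∧ dist b y < ε ∧
      AvoidingPath ((↑) '' E : Set (UniformSpace.Completion Z)) a b L := by
  have hd := dist_pos.2 hxy
  have hη : 0 < min (ε / 2) (dist x y / 8) := lt_min (by positivity) (by positivity)
  obtain ⟨x', hx'⟩ := UniformSpace.Completion.denseRange_coe.exists_dist_lt x hη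
  obtain ⟨y', hy'⟩ := UniformSpace.Completion.denseRange_coe.exists_dist_lt y hη
  have hx1 := hx'.trans_le (min_le_left _ _)
  have hx2 := hx'.trans_le (min_le_right _ _)
  have hy1 := hy'.trans_le (min_le_left _ _)
  have hy2 := hy'.trans_le (min_le_right _ _)
  have e : dist (x' : UniformSpace.Completion Z) y' = dist x' y' :=
    UniformSpace.Completion.dist_eq x' y'
  have u1 := dist_triangle4 x (x' : UniformSpace.Completion Z) y' y
  have u2 := dist_triangle4 (x' : UniformSpace.Completion Z) x y y'
  rw [dist_comm (y' : UniformSpace.Completion Z) y] at u1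
  rw [dist_comm (x' : UniformSpace.Completion Z) x] at u2
  rw [e] at u1 u2
  have hpos : 0 < dist x' y' := by linarith
  rw [lt_div_iff₀ (by positivity)] at hM
  obtain ⟨a, b, L, hL, ha, hb, hp⟩ := h.exists_path hK hE h0 (dist_pos.1 hpos) (by nlinarith)
    (half_pos hε)
  refine ⟨a, b, L, hL.trans (by nlinarith), ?_, ?_,
    hp.image UniformSpace.Completion.coe_isometry⟩
  · have := dist_triangle x (x' : UniformSpace.Completion Z) a
    rw [UniformSpace.Completion.dist_eq x' a] at this
    linarith
  · have := dist_triangle (b : UniformSpace.Completion Z) y' y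
    rw [UniformSpace.Completion.dist_eq b y', dist_comm (y' : UniformSpace.Completion Z) y] at this
    linarith

theorem LipschitzControl.exists_avoidingPath (hZ : LocallyComplete Z) [PolishSpace Z] [SFinite μ]
    [μ.IsOpenPosMeasure] {K M : ℝ} (h : LipschitzControl μ K M) (hK : 0 < K) {E : Set Z}
    (hE : MeasurableSet E) (h0 : μ E = 0) {x y : Z} (hM : dist x y < M / (3 * K)) :
    ∃ L ≤ 3 * K * dist x y, AvoidingPath E x y L := by
  rcases eq_or_ne x y with rfl | hxy
  · exact ⟨0, by simp, AvoidingPath.refl E x⟩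
  have hd := dist_pos.2 hxy
  obtain ⟨r, hr, hxr⟩ := Metric.isOpen_iff.1 hZ.isOpen_range_coe x (mem_range_self x)
  obtain ⟨s, hs, hys⟩ := Metric.isOpen_iff.1 hZ.isOpen_range_coe y (mem_range_self y)
  -- Filling a gap shorter than `ε` costs at most `6 * K * ε`. Two gaps then cost at most `K * dist
  -- x y` on top of `2 * K * dist x y`, and the filling paths stay in balls of the completion
  -- contained in `Z`.
  obtain ⟨ε, hε, hεd, hεr, hεs⟩ : ∃ ε > 0, 12 * ε ≤ dist x y ∧ 6 * K * ε ≤ r ∧ 6 * K * ε ≤ s := by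
    refine ⟨min (dist x y / 12) (min (r / (6 * K)) (s / (6 * K))),
      lt_min (by positivity) (lt_min (by positivity) (by positivity)), ?_, ?_, ?_⟩
    · linarith [min_le_left (dist x y / 12) (min (r / (6 * K)) (s / (6 * K)))]
    · rw [mul_comm, ← le_div_iff₀ (by positivity)]
      exact (min_le_right _ _).trans (min_le_left _ _)
    · rw [mul_comm, ← le_div_iff₀ (by positivity)]
      exact (min_le_right _ _).trans (min_le_right _ _)
  obtain ⟨a, b, L, hL, ha, hb, hp⟩ := h.exists_path hK hE h0 hxy (by
    rw [lt_div_iff₀ (by positivity)] at hM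
    nlinarith) hε
  have fill : ∀ (p q : Z) (t : ℝ), Metric.ball (p : UniformSpace.Completion Z) t ⊆
      range ((↑) : Z → UniformSpace.Completion Z) → 6 * K * ε ≤ t → dist p q < ε →
      AvoidingPath E p q (6 * K * dist p q) := by
    intro p q t hpt ht hpq
    have h1 : dist (p : UniformSpace.Completion Z) q < M / (3 * K) := by
      rw [UniformSpace.Completion.dist_eq]
      linarith
    have h2 := avoidingPath_of_approx (by positivity : 0 < 3 * K)
      (fun x y hxy hM ε hε => h.exists_path_completion hK hE h0 hxy hM hε) h1
    rw [UniformSpace.Completion.dist_eq, ← mul_assoc, show 2 * (3 : ℝ) = 6 by norm_num] at h2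
    refine h2.of_image UniformSpace.Completion.coe_isometry
      ((Metric.closedBall_subset_ball ?_).trans hpt)
    exact lt_of_lt_of_le (by gcongr) ht
  have hxa := fill x a r hxr hεr ha
  have hyb := fill y b s hys hεs (by rwa [dist_comm])
  refine ⟨_, ?_, (hxa.trans hp).trans hyb.symm⟩
  rw [dist_comm y b]
  nlinarith

end Thickness

/-! ### The equivalence -/

section Equivalence

variable {Z : Type*} [MetricSpace Z] [MeasurableSpace Z] {μ : Measure Z}

theorem IsAdmissible.isOpenPosMeasure (h : IsAdmissible μ) : μ.IsOpenPosMeasure := by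
  refine ⟨fun U hU hne => ?_⟩
  obtain ⟨z, hz⟩ := hne
  obtain ⟨r, hr, hrU⟩ := Metric.isOpen_iff.1 hU z hz
  exact ((h.ball_pos z r hr).trans_le (measure_mono hrU)).ne'

theorem VeryThickQuasiconvex.mono {C C' : ℝ≥0} (h : VeryThickQuasiconvex μ C ∞) (hC : C ≤ C') :
    VeryThickQuasiconvex μ C' ∞ := by
  rintro x₀ x hx y hy ⟨ρ, hρ, h0, hn⟩
  refine h x₀ x hx y hy ⟨ρ, hρ, h0, fun γ hγ => hn γ ?_⟩
  obtain ⟨h1, h2, h3, h4, h5⟩ := hγ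
  exact ⟨h1, h2, h3, h4, h5.trans (by gcongr)⟩

variable [TopologicalSpace.SeparableSpace Z]

theorem IsAdmissible.sFinite (h : IsAdmissible μ) : SFinite μ := by
  have : SecondCountableTopology Z := UniformSpace.secondCountable_of_separable Z
  have : IsLocallyFiniteMeasure μ :=
    ⟨fun z => ⟨Metric.ball z 1, Metric.ball_mem_nhds z one_pos, h.ball_lt_top z 1 one_pos⟩⟩
  infer_instance

variable [BorelSpace Z]

theorem LipschitzControl.veryThickQuasiconvex (hμ : IsAdmissible μ) {K M C : ℝ≥0}
    (h : LipschitzControl μ K M) (hK : 0 < K) (hM : 0 < M) (hC : Quasiconvex Z C) :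
    VeryThickQuasiconvex μ (3 * K * C) ∞ := by
  have := hμ.locallyComplete.polishSpace
  have := hμ.sFinite
  have := hμ.isOpenPosMeasure
  have hK' : (0 : ℝ) < K := hK
  have hM' : (0 : ℝ) < M := hM
  refine veryThickQuasiconvex_of_avoidingPath fun E hE h0 x y => ?_
  push_cast
  exact exists_avoidingPath_of_quasiconvex (by positivity : (0 : ℝ) < M / (3 * K)) (by positivity)
    hC (fun x y hxy => h.exists_avoidingPath hμ.locallyComplete hK' hE h0 hxy) x y

theorem veryThickQuasiconvex_of_condition1 (hμ : IsAdmissible μ) {c C : ℝ≥0} (hc : 0 < c)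
    (h : Condition1 μ c C) : VeryThickQuasiconvex μ (3 * (3 / c) * C) ∞ :=
  LipschitzControl.veryThickQuasiconvex (M := 1) hμ (lipschitzControl_of_normsComparable hc h.2.1)
    (by positivity) one_pos h.2.2

theorem veryThickQuasiconvex_of_lipSpace_eq (hμ : IsAdmissible μ) {C : ℝ≥0}
    (h : lipSpace μ = sobolev μ) (hC : Quasiconvex Z C) :
    ∃ K, VeryThickQuasiconvex μ K ∞ := by
  obtain ⟨K, hK, hc⟩ := exists_lipschitzControl_of_lipSpace_eq h
  exact ⟨_, LipschitzControl.veryThickQuasiconvex (M := 1) hμ hc hK one_pos hC⟩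

theorem veryThickQuasiconvex_of_condition3 (hμ : IsAdmissible μ) {K : ℝ≥0} (hK : 1 ≤ K)
    (h : Condition3 μ K) : VeryThickQuasiconvex μ (3 * (2 * K)) ∞ := by
  have := hμ.locallyComplete.polishSpace
  have := hμ.sFinite
  have := hμ.isOpenPosMeasure
  have hK' : (0 : ℝ) < (2 * K : ℝ≥0) := by
    have : 0 < K := zero_lt_one.trans_le hK
    positivity
  refine veryThickQuasiconvex_of_avoidingPath fun E hE h0 x y => ?_
  rw [NNReal.coe_mul, NNReal.coe_ofNat]
  -- The truncation level depends on the pair of points, chosen so that the admissible range is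
  -- `dist x y + 1`; no chaining is needed.
  refine (lipschitzControl_of_condition3 hK h
    ((dist x y + 1) * (3 * (2 * K : ℝ≥0)))).exists_avoidingPath hμ.locallyComplete hK' hE h0 ?_
  rw [mul_div_cancel_right₀ _ (by positivity)]
  linarith

end Equivalence

end ThickQC

end

/-! ### Assembly of the equivalences and their constants -/

theorem mainTheorem2 :
    -- the equivalence and the Poincare inequality, for each space
    (∀ (Z : Type u) [MetricSpace Z] [TopologicalSpace.SeparableSpace Z]
        [MeasurableSpace Z] [BorelSpace Z] (μ : Measure Z), ThickQC.IsAdmissible μ →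
      List.TFAE [
        ThickQC.lipSpace μ = ThickQC.sobolev μ ∧ ∃ C : ℝ≥0, 1 ≤ C ∧ ThickQC.Quasiconvex Z C,
        ∃ C : ℝ≥0, 1 ≤ C ∧ ThickQC.VeryThickQuasiconvex μ C ∞,
        ThickQC.lipSpace μ = ThickQC.sobolev μ ∧
          ∃ K : ℝ≥0, 1 ≤ K ∧ ThickQC.EnergiesComparable μ K] ∧
      ((∃ C : ℝ≥0, 1 ≤ C ∧ ThickQC.VeryThickQuasiconvex μ C ∞) →
        ∃ P Λ : ℝ≥0, 0 < P ∧ 1 ≤ Λ ∧ ThickQC.WeakPoincare μ P Λ)) ∧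
    -- the constants of each condition control those of the others, uniformly over all spaces
    (∀ c C₁ : ℝ≥0, 0 < c → c ≤ 1 → 1 ≤ C₁ →
      ∃ C K P Λ : ℝ≥0, 1 ≤ C ∧ 1 ≤ K ∧ 0 < P ∧ 1 ≤ Λ ∧
        ∀ (Z : Type u) [MetricSpace Z] [TopologicalSpace.SeparableSpace Z]
          [MeasurableSpace Z] [BorelSpace Z] (μ : Measure Z), ThickQC.IsAdmissible μ →
        ThickQC.Condition1 μ c C₁ →
          ThickQC.Condition2 μ C ∧ ThickQC.Condition3 μ K ∧ ThickQC.WeakPoincare μ P Λ) ∧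
    (∀ C : ℝ≥0, 1 ≤ C →
      ∃ c C₁ K P Λ : ℝ≥0, 0 < c ∧ c ≤ 1 ∧ 1 ≤ C₁ ∧ 1 ≤ K ∧ 0 < P ∧ 1 ≤ Λ ∧
        ∀ (Z : Type u) [MetricSpace Z] [TopologicalSpace.SeparableSpace Z]
          [MeasurableSpace Z] [BorelSpace Z] (μ : Measure Z), ThickQC.IsAdmissible μ →
        ThickQC.Condition2 μ C →
          ThickQC.Condition1 μ c C₁ ∧ ThickQC.Condition3 μ K ∧ ThickQC.WeakPoincare μ P Λ) ∧
    (∀ K : ℝ≥0, 1 ≤ K →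
      ∃ c C₁ C P Λ : ℝ≥0, 0 < c ∧ c ≤ 1 ∧ 1 ≤ C₁ ∧ 1 ≤ C ∧ 0 < P ∧ 1 ≤ Λ ∧
        ∀ (Z : Type u) [MetricSpace Z] [TopologicalSpace.SeparableSpace Z]
          [MeasurableSpace Z] [BorelSpace Z] (μ : Measure Z), ThickQC.IsAdmissible μ →
        ThickQC.Condition3 μ K →
          ThickQC.Condition1 μ c C₁ ∧ ThickQC.Condition2 μ C ∧ ThickQC.WeakPoincare μ P Λ) := by
  have hP : ∀ C : ℝ≥0, 1 ≤ C → 0 < C ∧ 1 ≤ 1 + 2 * C := fun C hC =>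
    ⟨zero_lt_one.trans_le hC, le_self_add⟩
  refine ⟨fun Z _ _ _ _ μ hμ => ⟨?_, ?_⟩, fun c C₁ hc hc1 hC₁ => ?_, fun C hC => ?_, fun K hK => ?_⟩
  · have := hμ.isOpenPosMeasure
    tfae_have 1 → 2 := by
      rintro ⟨h, C, -, hC⟩
      obtain ⟨K, hK⟩ := ThickQC.veryThickQuasiconvex_of_lipSpace_eq hμ h hC
      exact ⟨max 1 K, le_max_left _ _, hK.mono (le_max_right _ _)⟩
    tfae_have 2 → 1 := by
      rintro ⟨C, hC, h⟩
      exact ⟨h.lipSpace_eq, C, hC, h.quasiconvex⟩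
    tfae_have 2 → 3 := by
      rintro ⟨C, hC, h⟩
      exact ⟨h.lipSpace_eq, C, hC, (h.condition3 hC).2⟩
    tfae_have 3 → 2 := by
      rintro ⟨h, K, hK, hE⟩
      exact ⟨max 1 _, le_max_left _ _,
        (ThickQC.veryThickQuasiconvex_of_condition3 hμ hK ⟨h, hE⟩).mono (le_max_right _ _)⟩
    tfae_finish
  · rintro ⟨C, hC, h⟩
    exact ⟨C, 1 + 2 * C, (hP C hC).1, (hP C hC).2, h.weakPoincare hC hμ.ball_pos hμ.ball_lt_top⟩
  -- All other constants are read off from the thickness constant, through which every implication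
  -- passes.
  · have hM : 1 ≤ max 1 (3 * (3 / c) * C₁) := le_max_left _ _
    refine ⟨max 1 (3 * (3 / c) * C₁), max 1 (3 * (3 / c) * C₁), max 1 (3 * (3 / c) * C₁), _, hM, hM,
      (hP _ hM).1, (hP _ hM).2, fun Z _ _ _ _ μ hμ h => ?_⟩
    have := hμ.isOpenPosMeasure
    have h2 := (ThickQC.veryThickQuasiconvex_of_condition1 hμ hc h).mono (le_max_right 1 _)
    exact ⟨h2, h2.condition3 hM, h2.weakPoincare hM hμ.ball_pos hμ.ball_lt_top⟩
  · refine ⟨C⁻¹, C, C, C, _, inv_pos.2 (hP C hC).1, inv_le_one_of_one_le₀ hC, hC, hC, (hP C hC).1,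
      (hP C hC).2, fun Z _ _ _ _ μ hμ h => ?_⟩
    have := hμ.isOpenPosMeasure
    exact ⟨h.condition1 hC, h.condition3 hC, h.weakPoincare hC hμ.ball_pos hμ.ball_lt_top⟩
  · have hM : 1 ≤ max 1 (3 * (2 * K)) := le_max_left _ _
    refine ⟨(max 1 (3 * (2 * K)))⁻¹, max 1 (3 * (2 * K)), max 1 (3 * (2 * K)),
      max 1 (3 * (2 * K)), _, inv_pos.2 (hP _ hM).1, inv_le_one_of_one_le₀ hM, hM, hM, (hP _ hM).1,
      (hP _ hM).2, fun Z _ _ _ _ μ hμ h => ?_⟩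
    have := hμ.isOpenPosMeasure
    have h2 := (ThickQC.veryThickQuasiconvex_of_condition3 hμ hK h).mono (le_max_right 1 _)
    exact ⟨h2.condition1 hM, h2, h2.weakPoincare hM hμ.ball_pos hμ.ball_lt_top⟩
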